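/- Let $\mathcal X,\mathcal Y,\mathcal Z$ be finite sets and let $P_{XYZ}$ be a probability distribution on $\mathcal X\times\mathcal Y\times\mathcal Z$ such that $X-Y-Z$ is a Markov chain. An $(n,N_1,N_2)$-code consists of maps $f_1:\mathcal X^n\to\{1,\dots,N_1\}$, $f_2:\{1,\dots,N_1\}\times\mathcal Y^n\to\{1,\dots,N_2\}$, $g_1:\{1,\dots,N_1\}\times\mathcal Y^n\to\{\mathrm H_0,\mathrm H_1\}$ and $g_2:\{1,\dots,N_2\}\times\mathcal Z^n\to\{\mathrm H_0,\mathrm H_1\}$. Put $M_1=f_1(X^n)$ and $M_2=f_2(M_1,Y^n)$, and define $$\beta_1=\Pr\nolimits_{\mathrm H_0}[g_1(M_1,Y^n)=\mathrm H_1],\quad \beta_2=\Pr\nolimits_{\mathrm H_1}[g_1(M_1,Y^n)=\mathrm H_0],$$ $$\eta_1=\Pr\nolimits_{\mathrm H_0}[g_2(M_2,Z^n)=\mathrm H_1],\quad \eta_2=\Pr\nolimits_{\mathrm H_1}[g_2(M_2,Z^n)=\mathrm H_0],$$ where $(X^n,Y^n,Z^n)\sim P_{XYZ}^n$ under $\mathrm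 H_0$ and $(X^n,Y^n,Z^n)\sim P_X^nP_Y^nP_Z^n$ under $\mathrm H_1$ (with $P_X,P_Y,P_Z$ the marginals of $P_{XYZ}$). Let $\mathcal Q_2$ be the set of all joint distributions $Q=Q_{XYZU_1U_2V}$, with $U_1,U_2,V$ taking values in arbitrary finite sets, such that $Q_{XYZ}=P_{XYZ}$ and $U_1-X-Y$, $U_2-X-Y$, $V-Y-Z$ are Markov chains under $Q$. For $b_1,b_2,c,d\ge 0$ let $$\tilde{\mathrm R}_{b_1,b_2,c,d}=\min_{Q\in\mathcal Q_2}\Big\{-I_Q(U_1;Y)+b_1I_Q(U_1;X)+b_2I_Q(U_2;X)-c\big(I_Q(U_2;Y)+I_Q(V;Z)\big)+d\,I_Q(V;Y)\Big\},$$ where logarithms and mutual informations are to base $e$; this minimum is attained. Theorem. Let $\varepsilon_1,\varepsilon_2\in(0,1)$ with $\varepsilon_1+\varepsilon_2>1$ and let $b_1,b_2,c,d\ge 0$. There is a real sequence $(e_n)$ with $|e_n|=\Theta(n^{3/4}\log n)$ as $n\to\infty$, depending only on $P_{XYZ},\varepsilon_1,\varepsilon_2,b_1,b_2,c,d$, such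 that for all $n,N_1,N_2$ every $(n,N_1,N_2)$-code with $\beta_1\le\varepsilon_1$ and $\eta_1\le\varepsilon_2$ satisfies $$\log\beta_2+b_1\log N_1+b_2\log N_1+c\log\eta_2+d\log N_2\;\ge\; n\,\tilde{\mathrm R}_{b_1,b_2,c,d}+e_n .$$ -/

import Mathlib

open scoped BigOperators Asymptotics

noncomputable section

namespace TwoHop

/-- Probability of the event `E` under the mass function `q` on a finite set. -/
def prob {Ω : Type*} [Fintype Ω] (q : Ω → ℝ) (E : Set Ω) : ℝ :=
  ∑ ω, E.indicator q ω

/-- Probability mass function of the random variable `f` when the sample point has law `q`. -/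
def law {Ω A : Type*} [Fintype Ω] (q : Ω → ℝ) (f : Ω → A) (a : A) : ℝ :=
  prob q {ω | f ω = a}

/-- Mutual information `I_q(f; g)` in nats. A pair of joint probability zero contributes `0`;
where the joint probability is positive, so are the marginal ones. -/
def mutualInfo {Ω A B : Type*} [Fintype Ω] [Fintype A] [Fintype B]
    (q : Ω → ℝ) (f : Ω → A) (g : Ω → B) : ℝ :=
  ∑ a, ∑ b, law q (fun ω => (f ω, g ω)) (a, b) *
    Real.log (law q (fun ω => (f ω, g ω)) (a, b) / (law q f a * law q g b))

/-- The Markov chain `f - g - h` under `q`: given `g`, the variables `f` and `h` are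
conditionally independent (written without division). -/
def IsMarkovChain {Ω A B C : Type*} [Fintype Ω]
    (q : Ω → ℝ) (f : Ω → A) (g : Ω → B) (h : Ω → C) : Prop :=
  ∀ a b c, law q (fun ω => (f ω, g ω, h ω)) (a, b, c) * law q g b =
    law q (fun ω => (f ω, g ω)) (a, b) * law q (fun ω => (g ω, h ω)) (b, c)

/-- The two hypotheses. -/
inductive Hypothesis
  | H0
  | H1

/-- An `(n, N₁, N₂)`-code for hypothesis testing over a two-hop network. -/
structure Code (X Y Z : Type*) (n N₁ N₂ : ℕ) where
  /-- encoder of the transmitter -/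
  f₁ : (Fin n → X) → Fin N₁
  /-- encoder of the relay -/
  f₂ : Fin N₁ → (Fin n → Y) → Fin N₂
  /-- decoder of the relay -/
  g₁ : Fin N₁ → (Fin n → Y) → Hypothesis
  /-- decoder of the receiver -/
  g₂ : Fin N₂ → (Fin n → Z) → Hypothesis

section Errors

variable {X Y Z : Type*} [Fintype X] [Fintype Y] [Fintype Z] {n N₁ N₂ : ℕ}

/-- Law of `(Xⁿ, Yⁿ, Zⁿ)` under the null hypothesis: the triples are i.i.d. with law `P`. -/
def nullLaw (P : X × Y × Z → ℝ) (n : ℕ) :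
    (Fin n → X) × (Fin n → Y) × (Fin n → Z) → ℝ :=
  fun s => ∏ i, P (s.1 i, s.2.1 i, s.2.2 i)

/-- Law of `(Xⁿ, Yⁿ, Zⁿ)` under the alternative hypothesis: the same marginals `P_X`, `P_Y`,
`P_Z`, but the three sequences are independent. -/
def altLaw (P : X × Y × Z → ℝ) (n : ℕ) :
    (Fin n → X) × (Fin n → Y) × (Fin n → Z) → ℝ :=
  fun s => (∏ i, law P (fun t => t.1) (s.1 i)) * (∏ i, law P (fun t => t.2.1) (s.2.1 i)) *
    ∏ i, law P (fun t => t.2.2) (s.2.2 i)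

/-- The decision of the relay, as a function of the source sequences. -/
def Code.relayDecision (K : Code X Y Z n N₁ N₂)
    (s : (Fin n → X) × (Fin n → Y) × (Fin n → Z)) : Hypothesis :=
  K.g₁ (K.f₁ s.1) s.2.1

/-- The decision of the receiver, as a function of the source sequences. -/
def Code.receiverDecision (K : Code X Y Z n N₁ N₂)
    (s : (Fin n → X) × (Fin n → Y) × (Fin n → Z)) : Hypothesis :=
  K.g₂ (K.f₂ (K.f₁ s.1) s.2.1) s.2.2

/-- Type-I error probability at the relay. -/
def Code.β₁ (K : Code X Y Z n N₁ N₂) (P : X × Y × Z → ℝ) : ℝ :=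
  prob (nullLaw P n) {s | K.relayDecision s = Hypothesis.H1}

/-- Type-II error probability at the relay. -/
def Code.β₂ (K : Code X Y Z n N₁ N₂) (P : X × Y × Z → ℝ) : ℝ :=
  prob (altLaw P n) {s | K.relayDecision s = Hypothesis.H0}

/-- Type-I error probability at the receiver. -/
def Code.η₁ (K : Code X Y Z n N₁ N₂) (P : X × Y × Z → ℝ) : ℝ :=
  prob (nullLaw P n) {s | K.receiverDecision s = Hypothesis.H1}

/-- Type-II error probability at the receiver. -/
def Code.η₂ (K : Code X Y Z n N₁ N₂) (P : X × Y × Z → ℝ) : ℝ :=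
  prob (altLaw P n) {s | K.receiverDecision s = Hypothesis.H0}

end Errors

section Region

variable {X Y Z U₁ U₂ V : Type*} [Fintype X] [Fintype Y] [Fintype Z]
  [Fintype U₁] [Fintype U₂] [Fintype V]

/-- The joint distributions of `(X, Y, Z, U₁, U₂, V)` whose `(X, Y, Z)`-marginal is `P` and which
satisfy the Markov chains `U₁ - X - Y`, `U₂ - X - Y` and `V - Y - Z`. -/
structure IsAdmissible (P : X × Y × Z → ℝ) (Q : X × Y × Z × U₁ × U₂ × V → ℝ) : Prop where
  mem_simplex : Q ∈ stdSimplex ℝ (X × Y × Z × U₁ × U₂ × V)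
  law_source : law Q (fun ω => (ω.1, ω.2.1, ω.2.2.1)) = P
  markov_U₁ : IsMarkovChain Q (fun ω => ω.2.2.2.1) (fun ω => ω.1) (fun ω => ω.2.1)
  markov_U₂ : IsMarkovChain Q (fun ω => ω.2.2.2.2.1) (fun ω => ω.1) (fun ω => ω.2.1)
  markov_V : IsMarkovChain Q (fun ω => ω.2.2.2.2.2) (fun ω => ω.2.1) (fun ω => ω.2.2.1)

/-- `- I(U₁;Y) + b₁ I(U₁;X) + b₂ I(U₂;X) - c (I(U₂;Y) + I(V;Z)) + d I(V;Y)` under `Q`. -/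
def weightedInfo (b₁ b₂ c d : ℝ) (Q : X × Y × Z × U₁ × U₂ × V → ℝ) : ℝ :=
  - mutualInfo Q (fun ω => ω.2.2.2.1) (fun ω => ω.2.1)
    + b₁ * mutualInfo Q (fun ω => ω.2.2.2.1) (fun ω => ω.1)
    + b₂ * mutualInfo Q (fun ω => ω.2.2.2.2.1) (fun ω => ω.1)
    - c * (mutualInfo Q (fun ω => ω.2.2.2.2.1) (fun ω => ω.2.1)
        + mutualInfo Q (fun ω => ω.2.2.2.2.2) (fun ω => ω.2.2.1))
    + d * mutualInfo Q (fun ω => ω.2.2.2.2.2) (fun ω => ω.2.1)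

/-- The values of the weighted information over all admissible distributions, where the auxiliary
variables `U₁`, `U₂`, `V` range over arbitrary finite alphabets. -/
def weightedInfoValues (P : X × Y × Z → ℝ) (b₁ b₂ c d : ℝ) : Set ℝ :=
  {r | ∃ (k₁ k₂ k₃ : ℕ) (Q : X × Y × Z × Fin k₁ × Fin k₂ × Fin k₃ → ℝ),
    IsAdmissible P Q ∧ r = weightedInfo b₁ b₂ c d Q}

/-- The optimal value of the weighted information over all admissible distributions. -/
def RTilde (P : X × Y × Z → ℝ) (b₁ b₂ c d : ℝ) : ℝ :=
  sInf (weightedInfoValues P b₁ b₂ c d)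

end Region

end TwoHop

end

/-!
The optimisation over `Q` splits: `U₁`, `U₂` and `V` enter the weighted information separately, so
its minimum is a sum of three minima of the form `min (b I(U; X) - c I(U; Y))` over `U - X - Y`,
for the pairs `(X, Y)`, `(X, Y)` and `(Y, Z)`. Each is the lower convex envelope at `p_X` of
`v ↦ b D(v ‖ p_X) - c D(v p_{Y|X} ‖ p_Y)` (`infoFn`). The envelope is attained since the convex hull
of a compact graph is compact, and it has an affine minorant touching it at `p_X` by the Hahn-Banach
theorem (`exists_lower_envelope`, `exists_infoFn_envelope`). This gives the first claim
(`isLeast_weightedInfoValues`).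

For the converse, the null law is conditioned on acceptance, separately for the test of the relay
and for that of the receiver. The conditioned law `q` has density at most `1 / (1 - ε)`, so all
relative entropies of `q` with respect to the null law are bounded. Data processing bounds
`-log β₂` by `I(M₁; Yⁿ)`, and `-log η₂` by `I(M₁; Yⁿ) + I(M₂; Zⁿ)`, up to constants, and
`log N₁`, `log N₂` bound the entropies of the messages (`exists_transmitter_converse`,
`exists_relay_receiver_converse`). Since each test has its own change of measure, the bounds for
the two tests may simply be added.

It remains to compare `n`-letter information under `q` with the single-letter minimum, although `q`
is not i.i.d. and does not respect the channel. The constraint that `Y` be the output of the channel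
is replaced by the penalty `α D(v ‖ v_X p_{Y|X})`. With the affine minorant, the penalised problem
becomes an inequality between entropies and a linear functional, valid for every coupling `v`
(`exists_entropyFunctional_nonneg`); it tensorizes by strong subadditivity of the entropy
(`entropyFunctional_nonneg_tensor`). By the Hölder continuity of `t log t` and the Hellinger bound,
the penalised minimum is within `O(α ^ (-1/3))` of the original one. The total error is
`O(n α ^ (-1/3) + α + √n)`, where `√n` bounds the fluctuation of the linear functional under `q`,
and `α` of order `n ^ (3/4)` makes this `O(n ^ (3/4))` (`exists_multiletter_converse`).
-/

noncomputable section

namespace TwoHop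

open Real Filter Topology

universe u

/-! ### Laws of random variables on a finite sample space -/

section Laws

variable {Ω A B C D : Type*} [Fintype Ω] {q p : Ω → ℝ}

open Classical in
lemma law_eq_sum_ite (q : Ω → ℝ) (f : Ω → A) (a : A) :
    law q f a = ∑ ω, if f ω = a then q ω else 0 := by
  simp [law, prob, Set.indicator_apply]

lemma law_nonneg (hq : ∀ ω, 0 ≤ q ω) (f : Ω → A) (a : A) : 0 ≤ law q f a := by
  classical
  rw [law_eq_sum_ite]
  exact Finset.sum_nonneg fun ω _ => by split_ifs <;> simp [hq]

lemma le_law (hq : ∀ ω, 0 ≤ q ω) (f : Ω → A) (ω : Ω) : q ω ≤ law q f (f ω) := by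
  classical
  rw [law_eq_sum_ite]
  refine le_trans ?_ (Finset.single_le_sum (f := fun ω' => if f ω' = f ω then q ω' else 0)
    (fun ω' _ => by split_ifs <;> simp [hq]) (Finset.mem_univ ω))
  simp

lemma law_pos (hq : ∀ ω, 0 ≤ q ω) (f : Ω → A) {ω : Ω} (h : q ω ≠ 0) : 0 < law q f (f ω) :=
  lt_of_lt_of_le (lt_of_le_of_ne (hq ω) h.symm) (le_law hq f ω)

lemma law_mono (h : ∀ ω, q ω ≤ p ω) (f : Ω → A) (a : A) : law q f a ≤ law p f a := by
  classical
  simp only [law_eq_sum_ite]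
  exact Finset.sum_le_sum fun ω _ => by split_ifs <;> simp [h]

lemma law_const_mul (t : ℝ) (q : Ω → ℝ) (f : Ω → A) (a : A) :
    law (fun ω => t * q ω) f a = t * law q f a := by
  classical
  simp only [law_eq_sum_ite, Finset.mul_sum, mul_ite, mul_zero]

/-- Change of variables: the integral of a function of `f` against the law of `f`. -/
lemma sum_law_mul [Fintype A] (q : Ω → ℝ) (f : Ω → A) (G : A → ℝ) :
    ∑ a, law q f a * G a = ∑ ω, q ω * G (f ω) := by
  classical
  simp only [law_eq_sum_ite, Finset.sum_mul, ite_mul, zero_mul]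
  rw [Finset.sum_comm]
  simp

lemma sum_law [Fintype A] (q : Ω → ℝ) (f : Ω → A) : ∑ a, law q f a = ∑ ω, q ω := by
  simpa using sum_law_mul q f fun _ => 1

lemma law_mem_stdSimplex [Fintype A] (hq : q ∈ stdSimplex ℝ Ω) (f : Ω → A) :
    law q f ∈ stdSimplex ℝ A :=
  ⟨law_nonneg hq.1 f, by rw [sum_law, hq.2]⟩

lemma law_comp [Fintype A] (q : Ω → ℝ) (f : Ω → A) (φ : A → B) :
    law q (fun ω => φ (f ω)) = law (law q f) φ := by
  classical
  funext b
  rw [law_eq_sum_ite, law_eq_sum_ite]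
  have := sum_law_mul q f fun a => if φ a = b then 1 else 0
  simpa using this.symm

lemma law_fst_eq_sum [Fintype A] [Fintype B] (p : A × B → ℝ) (a : A) :
    law p (fun t => t.1) a = ∑ b, p (a, b) := by
  classical
  rw [law_eq_sum_ite, Fintype.sum_prod_type, Finset.sum_eq_single a] <;> simp +contextual

lemma law_snd_eq_sum [Fintype A] [Fintype B] (p : A × B → ℝ) (b : B) :
    law p (fun t => t.2) b = ∑ a, p (a, b) := by
  classical
  rw [law_eq_sum_ite, Fintype.sum_prod_type_right, Finset.sum_eq_single b] <;> simp +contextual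

lemma law_eq_sum_pair_left [Fintype A] [Fintype B] (q : Ω → ℝ) (f : Ω → A) (g : Ω → B) (a : A) :
    law q f a = ∑ b, law q (fun ω => (f ω, g ω)) (a, b) := by
  rw [← law_fst_eq_sum, ← law_comp]

lemma law_eq_sum_pair_right [Fintype A] [Fintype B] (q : Ω → ℝ) (f : Ω → A) (g : Ω → B) (b : B) :
    law q g b = ∑ a, law q (fun ω => (f ω, g ω)) (a, b) := by
  rw [← law_snd_eq_sum, ← law_comp]

lemma law_congr_of_iff (q : Ω → ℝ) {f : Ω → A} {g : Ω → B} {a : A} {b : B}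
    (h : ∀ ω, f ω = a ↔ g ω = b) : law q f a = law q g b := by
  classical
  simp only [law_eq_sum_ite, h]

lemma law_le_of_imp (hq : ∀ ω, 0 ≤ q ω) {f : Ω → A} {g : Ω → B} {a : A} {b : B}
    (h : ∀ ω, f ω = a → g ω = b) : law q f a ≤ law q g b := by
  classical
  simp only [law_eq_sum_ite]
  refine Finset.sum_le_sum fun ω _ => ?_
  by_cases h1 : f ω = a
  · simp [h1, h ω h1]
  · simp only [h1, if_false]
    split_ifs <;> simp [hq]

end Laws

/-! ### Entropy, cross entropy and data processing -/

section Entropy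

variable {Ω A B C D : Type*} [Fintype Ω] {q p : Ω → ℝ}

/-- Cross entropy `-∑ q(ω) log p_f(f(ω))` of the variable `f`, where `p_f` is the law of `f`
under `p`. The mass functions need not be normalised. -/
def crossEnt (q p : Ω → ℝ) (f : Ω → A) : ℝ := -∑ ω, q ω * log (law p f (f ω))

/-- Entropy `-∑ q_f(a) log q_f(a)` of the variable `f`, written as a sum over the sample space so
that its alphabet need not be finite. The mass function `q` need not be normalised. -/
def ent (q : Ω → ℝ) (f : Ω → A) : ℝ := crossEnt q q f

lemma ent_eq_sum_negMulLog [Fintype A] (q : Ω → ℝ) (f : Ω → A) :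
    ent q f = ∑ a, negMulLog (law q f a) := by
  rw [ent, crossEnt, ← sum_law_mul q f fun a => log (law q f a), ← Finset.sum_neg_distrib]
  simp [negMulLog]

lemma ent_congr (q : Ω → ℝ) {f : Ω → A} {g : Ω → B} (h : ∀ ω ω', f ω = f ω' ↔ g ω = g ω') :
    ent q f = ent q g := by
  unfold ent crossEnt
  congr 1
  exact Finset.sum_congr rfl fun ω _ => by rw [law_congr_of_iff q fun ω' => h ω' ω]

/-- A function of a variable has at most the entropy of that variable. -/
lemma ent_le_of_imp (hq : ∀ ω, 0 ≤ q ω) {f : Ω → A} {g : Ω → B}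
    (h : ∀ ω ω', f ω = f ω' → g ω = g ω') : ent q g ≤ ent q f := by
  unfold ent crossEnt
  refine neg_le_neg (Finset.sum_le_sum fun ω _ => ?_)
  by_cases h0 : q ω = 0
  · simp [h0]
  · exact mul_le_mul_of_nonneg_left
      (log_le_log (law_pos hq f h0) (law_le_of_imp hq fun ω' => h ω' ω)) (hq ω)

lemma sub_le_mul_log_sub {x y : ℝ} (hx : 0 ≤ x) (hy : 0 ≤ y) (h : y = 0 → x = 0) :
    x - y ≤ x * log x - x * log y := by
  rcases hx.eq_or_lt with rfl | hx
  · simpa using hy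
  have hy' : 0 < y := lt_of_le_of_ne hy fun h0 => hx.ne' (h h0.symm)
  have h1 := log_le_sub_one_of_pos (div_pos hy' hx)
  rw [log_div hy'.ne' hx.ne'] at h1
  have h2 := mul_le_mul_of_nonneg_left h1 hx.le
  rw [mul_sub, mul_sub, mul_div_cancel₀ _ hx.ne'] at h2
  linarith

lemma exists_ne_zero_of_mem_stdSimplex (hq : q ∈ stdSimplex ℝ Ω) : ∃ ω, q ω ≠ 0 := by
  by_contra! h
  have := hq.2
  simp [h] at this

/-- Gibbs' inequality: replacing the law of `f` by another subprobability `y` in the definition of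
the entropy can only increase the value. -/
lemma ent_le_of_sum_le [Fintype A] (hq : ∀ ω, 0 ≤ q ω) (f : Ω → A) (y : A → ℝ)
    (hy : ∀ a, 0 ≤ y a) (hpos : ∀ ω, q ω ≠ 0 → y (f ω) ≠ 0) (hsum : ∑ a, y a ≤ ∑ ω, q ω) :
    ent q f ≤ -∑ ω, q ω * log (y (f ω)) := by
  classical
  have h0 : ∀ a, y a = 0 → law q f a = 0 := by
    intro a ha
    rw [law_eq_sum_ite]
    refine Finset.sum_eq_zero fun ω _ => ?_
    split_ifs with h
    · by_contra h1
      exact hpos ω h1 (h ▸ ha)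
    · rfl
  have h1 : ∑ a, (law q f a - y a) ≤
      ∑ a, (law q f a * log (law q f a) - law q f a * log (y a)) :=
    Finset.sum_le_sum fun a _ => sub_le_mul_log_sub (law_nonneg hq f a) (hy a) (h0 a)
  rw [Finset.sum_sub_distrib, Finset.sum_sub_distrib, sum_law,
    sum_law_mul q f fun a => log (law q f a), sum_law_mul q f fun a => log (y a)] at h1
  unfold ent crossEnt
  linarith

lemma ent_le_crossEnt [Fintype A] (hq : ∀ ω, 0 ≤ q ω) (hp : ∀ ω, 0 ≤ p ω)
    (hqp : ∀ ω, q ω ≠ 0 → p ω ≠ 0) (hsum : ∑ ω, p ω ≤ ∑ ω, q ω) (f : Ω → A) :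
    ent q f ≤ crossEnt q p f :=
  ent_le_of_sum_le hq f (law p f) (law_nonneg hp f)
    (fun ω h => (law_pos hp f (hqp ω h)).ne') (by rwa [sum_law])

/-- Data processing: the relative entropy `crossEnt - ent` of a function of `f` is at most that
of `f`. -/
lemma crossEnt_sub_ent_comp_le [Fintype A] [Fintype B] (hq : ∀ ω, 0 ≤ q ω) (hp : ∀ ω, 0 ≤ p ω)
    (hqp : ∀ ω, q ω ≠ 0 → p ω ≠ 0) (f : Ω → A) (φ : A → B) :
    crossEnt q p (fun ω => φ (f ω)) - ent q (fun ω => φ (f ω)) ≤ crossEnt q p f - ent q f := by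
  classical
  set g : Ω → B := fun ω => φ (f ω) with hg
  -- the law of `f` under `p`, reweighted so that `φ` has its law under `q`
  have h := ent_le_of_sum_le hq f (fun a => law p f a * (law q g (φ a) / law p g (φ a)))
    (fun a => mul_nonneg (law_nonneg hp f a)
      (div_nonneg (law_nonneg hq g _) (law_nonneg hp g _)))
    (fun ω h => by
      have h1 := law_pos hp f (hqp ω h)
      have h2 := law_pos hp g (hqp ω h)
      have h3 := law_pos hq g h
      simp only [hg] at h2 h3
      positivity)
    (by
      rw [sum_law_mul p f fun a => law q g (φ a) / law p g (φ a),
        ← sum_law_mul p g fun b => law q g b / law p g b, ← sum_law q g]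
      refine Finset.sum_le_sum fun b _ => ?_
      by_cases h0 : law p g b = 0
      · simpa [h0] using law_nonneg hq g b
      · rw [mul_div_cancel₀ _ h0])
  have h2 : ∑ ω, q ω * log (law p f (f ω) * (law q g (φ (f ω)) / law p g (φ (f ω)))) =
      ∑ ω, (q ω * log (law p f (f ω)) + q ω * log (law q g (g ω)) - q ω * log (law p g (g ω))) := by
    refine Finset.sum_congr rfl fun ω _ => ?_
    by_cases h0 : q ω = 0
    · simp [h0]
    · have h1 := law_pos hp f (hqp ω h0)
      have h2 := law_pos hp g (hqp ω h0)
      have h3 := law_pos hq g h0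
      simp only [hg] at h2 h3 ⊢
      rw [log_mul h1.ne' (div_pos h3 h2).ne', log_div h3.ne' h2.ne']
      ring
  rw [h2, Finset.sum_sub_distrib, Finset.sum_add_distrib] at h
  simp only [crossEnt, ent] at h ⊢
  linarith

/-- Strong subadditivity of the entropy, that is, nonnegativity of `I(g; h | f)`. -/
lemma ent_submodular [Fintype A] [Fintype B] [Fintype C] (hq : ∀ ω, 0 ≤ q ω)
    (f : Ω → A) (g : Ω → B) (h : Ω → C) :
    ent q (fun ω => (f ω, g ω, h ω)) + ent q f ≤
      ent q (fun ω => (f ω, g ω)) + ent q (fun ω => (f ω, h ω)) := by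
  classical
  -- compare with the law that makes `g` and `h` conditionally independent given `f`
  have key := ent_le_of_sum_le hq (fun ω => (f ω, g ω, h ω))
    (fun t => law q (fun ω => (f ω, g ω)) (t.1, t.2.1) *
      law q (fun ω => (f ω, h ω)) (t.1, t.2.2) / law q f t.1)
    (fun t => div_nonneg (mul_nonneg (law_nonneg hq _ _) (law_nonneg hq _ _)) (law_nonneg hq _ _))
    (fun ω h0 => by
      have h1 := law_pos hq f h0
      have h2 := law_pos hq (fun ω => (f ω, g ω)) h0
      have h3 := law_pos hq (fun ω => (f ω, h ω)) h0
      simp only at h2 h3 ⊢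
      positivity)
    (by
      simp only [Fintype.sum_prod_type]
      rw [← sum_law q f]
      refine Finset.sum_le_sum fun a _ => ?_
      simp only [← Finset.sum_div, ← Finset.mul_sum, ← Finset.sum_mul]
      rw [← law_eq_sum_pair_left, ← law_eq_sum_pair_left]
      by_cases h0 : law q f a = 0
      · simp [h0]
      · rw [mul_div_cancel_right₀ _ h0])
  have h2 : ∑ ω, q ω * log (law q (fun ω => (f ω, g ω)) (f ω, g ω) *
      law q (fun ω => (f ω, h ω)) (f ω, h ω) / law q f (f ω)) =
      ∑ ω, (q ω * log (law q (fun ω => (f ω, g ω)) (f ω, g ω)) +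
        q ω * log (law q (fun ω => (f ω, h ω)) (f ω, h ω)) - q ω * log (law q f (f ω))) := by
    refine Finset.sum_congr rfl fun ω _ => ?_
    by_cases h0 : q ω = 0
    · simp [h0]
    · have h1 := law_pos hq f h0
      have h2 := law_pos hq (fun ω => (f ω, g ω)) h0
      have h3 := law_pos hq (fun ω => (f ω, h ω)) h0
      rw [log_div (mul_pos h2 h3).ne' h1.ne', log_mul h2.ne' h3.ne']
      ring
  simp only at key
  rw [h2, Finset.sum_sub_distrib, Finset.sum_add_distrib] at key
  simp only [crossEnt, ent] at key ⊢
  linarith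

lemma ent_le_log_card [Fintype A] [Nonempty A] (hq : q ∈ stdSimplex ℝ Ω) (f : Ω → A) :
    ent q f ≤ log (Fintype.card A) := by
  have hc : (0 : ℝ) < Fintype.card A := by exact_mod_cast Fintype.card_pos
  have h := ent_le_of_sum_le hq.1 f (fun _ => (Fintype.card A : ℝ)⁻¹) (fun _ => by positivity)
    (fun _ _ => by positivity) (by simp [hq.2, hc.ne'])
  rw [← Finset.sum_mul, hq.2] at h
  simpa using h

/-- If `q ≤ p / δ`, then every variable has relative entropy at most `-log δ`. -/
lemma crossEnt_le_ent_sub_log {δ : ℝ} (hδ : 0 < δ) (hq : q ∈ stdSimplex ℝ Ω)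
    (hqp : ∀ ω, δ * q ω ≤ p ω) (f : Ω → A) : crossEnt q p f ≤ ent q f - log δ := by
  have h : ∑ ω, (q ω * log δ + q ω * log (law q f (f ω))) ≤ ∑ ω, q ω * log (law p f (f ω)) := by
    refine Finset.sum_le_sum fun ω _ => ?_
    by_cases h0 : q ω = 0
    · simp [h0]
    · have h1 := law_pos hq.1 f h0
      rw [← mul_add, ← log_mul hδ.ne' h1.ne']
      refine mul_le_mul_of_nonneg_left (log_le_log (by positivity) ?_) (hq.1 ω)
      rw [← law_const_mul]
      exact law_mono hqp f _
  rw [Finset.sum_add_distrib, ← Finset.sum_mul, hq.2] at h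
  simp only [crossEnt, ent]
  linarith

lemma ne_zero_of_mul_le {ι : Type*} {q p : ι → ℝ} {δ : ℝ} (hδ : 0 < δ) (hq : ∀ ω, 0 ≤ q ω)
    (hqp : ∀ ω, δ * q ω ≤ p ω) {ω : ι} (h : q ω ≠ 0) : p ω ≠ 0 :=
  ((mul_pos hδ ((hq ω).lt_of_ne' h)).trans_le (hqp ω)).ne'

/-- A test that accepts surely under `q` accepts under `p` with probability at least
`exp (-D(q_f ‖ p_f))`. -/
lemma neg_log_prob_le [Fintype A] (hq : q ∈ stdSimplex ℝ Ω) (hp : ∀ ω, 0 ≤ p ω)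
    (hqp : ∀ ω, q ω ≠ 0 → p ω ≠ 0) (f : Ω → A) (E : Set A) (hE : ∀ ω, q ω ≠ 0 → f ω ∈ E) :
    -log (prob p {ω | f ω ∈ E}) ≤ crossEnt q p f - ent q f := by
  classical
  set β := prob p {ω | f ω ∈ E} with hβ
  have hβ' : β = ∑ a, law p f a * (if a ∈ E then 1 else 0) := by
    rw [sum_law_mul]
    simp [hβ, prob, Set.indicator_apply]
  obtain ⟨ω₀, h₀⟩ := exists_ne_zero_of_mem_stdSimplex hq
  have hβpos : 0 < β := by
    have h1 := law_pos hp f (hqp ω₀ h₀)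
    rw [hβ']
    refine lt_of_lt_of_le ?_ (Finset.single_le_sum
      (f := fun a => law p f a * (if a ∈ E then 1 else 0)) (fun a _ => ?_)
      (Finset.mem_univ (f ω₀)))
    · simpa [hE ω₀ h₀] using h1
    · have := law_nonneg hp f a
      positivity
  have h := ent_le_of_sum_le hq.1 f (fun a => law p f a * (if a ∈ E then 1 else 0) / β)
    (fun a => by
      have := law_nonneg hp f a
      positivity)
    (fun ω h => by
      have h1 := law_pos hp f (hqp ω h)
      simp only [hE ω h, if_true]
      positivity)
    (by rw [← Finset.sum_div, ← hβ', div_self hβpos.ne', hq.2])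
  have h2 : ∑ ω, q ω * log (law p f (f ω) * (if f ω ∈ E then 1 else 0) / β) =
      ∑ ω, (q ω * log (law p f (f ω)) - q ω * log β) := by
    refine Finset.sum_congr rfl fun ω _ => ?_
    by_cases h0 : q ω = 0
    · simp [h0]
    · have h1 := law_pos hp f (hqp ω h0)
      rw [if_pos (hE ω h0), mul_one, log_div h1.ne' hβpos.ne', mul_sub]
  rw [h2, Finset.sum_sub_distrib, ← Finset.sum_mul, hq.2] at h
  simp only [crossEnt, ent] at h ⊢
  linarith

/-- `I(f; g) = H(f) + H(g) - H(f, g)`. -/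
lemma mutualInfo_eq_ent [Fintype A] [Fintype B] (hq : ∀ ω, 0 ≤ q ω) (f : Ω → A) (g : Ω → B) :
    mutualInfo q f g = ent q f + ent q g - ent q (fun ω => (f ω, g ω)) := by
  have h := sum_law_mul q (fun ω => (f ω, g ω)) fun t =>
    log (law q (fun ω => (f ω, g ω)) t / (law q f t.1 * law q g t.2))
  rw [Fintype.sum_prod_type] at h
  have h2 : ∑ ω, q ω * log (law q (fun ω => (f ω, g ω)) (f ω, g ω) /
      (law q f (f ω) * law q g (g ω))) =
      ∑ ω, (q ω * log (law q (fun ω => (f ω, g ω)) (f ω, g ω)) - (q ω * log (law q f (f ω))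
        + q ω * log (law q g (g ω)))) := by
    refine Finset.sum_congr rfl fun ω _ => ?_
    by_cases h0 : q ω = 0
    · simp [h0]
    · have h1 := law_pos hq f h0
      have h2 := law_pos hq g h0
      have h3 := law_pos hq (fun ω => (f ω, g ω)) h0
      rw [log_div h3.ne' (mul_pos h1 h2).ne', log_mul h1.ne' h2.ne']
      ring
  rw [mutualInfo, h, h2, Finset.sum_sub_distrib, Finset.sum_add_distrib]
  simp only [crossEnt, ent]
  ring

end Entropy

/-! ### Lower convex envelopes -/

section ConvexHull

/-- In finite dimension the convex hull of a compact set is compact, by Carathéodory's theorem. -/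
lemma isCompact_convexHull_of_finiteDimensional {E : Type*} [NormedAddCommGroup E]
    [NormedSpace ℝ E] [FiniteDimensional ℝ E] {s : Set E} (hs : IsCompact s) :
    IsCompact (convexHull ℝ s) := by
  rcases s.eq_empty_or_nonempty with rfl | ⟨s₀, hs₀⟩
  · simp
  set N := Module.finrank ℝ E + 1
  let F : (Fin N → ℝ) × (Fin N → E) → E := fun t => ∑ i, t.1 i • t.2 i
  have hF : Continuous F := by fun_prop
  have hT : IsCompact (stdSimplex ℝ (Fin N) ×ˢ Set.univ.pi fun _ : Fin N => s) :=
    (isCompact_stdSimplex ℝ (Fin N)).prod (isCompact_univ_pi fun _ => hs)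
  convert hT.image hF using 1
  ext x
  constructor
  · intro hx
    obtain ⟨ι, _, z, w, hz, hind, hw, hw1, rfl⟩ := eq_pos_convex_span_of_mem_convexHull hx
    have hcard : Fintype.card ι ≤ Fintype.card (Fin N) := by
      simpa [N] using hind.card_le_finrank_succ.trans
        (Nat.succ_le_succ (Submodule.finrank_le _))
    obtain ⟨e⟩ := Function.Embedding.nonempty_of_card_le hcard
    have hout : ∀ j, j ∉ Set.range e → Function.extend e w 0 j = 0 := fun j hj => by
      rw [Function.extend_apply' _ _ _ hj]; rfl
    refine ⟨(Function.extend e w 0, Function.extend e z fun _ => s₀), ⟨⟨?_, ?_⟩, ?_⟩, ?_⟩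
    · intro j
      by_cases hj : j ∈ Set.range e
      · obtain ⟨i, rfl⟩ := hj
        simpa [e.injective.extend_apply] using (hw i).le
      · exact (hout j hj).ge
    · rw [← hw1]
      exact (Fintype.sum_of_injective e e.injective _ _ hout
        fun i => (e.injective.extend_apply _ _ _).symm).symm
    · intro j _
      by_cases hj : j ∈ Set.range e
      · obtain ⟨i, rfl⟩ := hj
        simpa [e.injective.extend_apply] using hz ⟨i, rfl⟩
      · simpa [Function.extend_apply' _ _ _ hj] using hs₀
    · refine (Fintype.sum_of_injective e e.injective _ _ (fun j hj => ?_) fun i => ?_).symm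
      · simp [hout j hj]
      · simp [e.injective.extend_apply]
  · rintro ⟨⟨w, z⟩, ⟨hw, hz⟩, rfl⟩
    exact mem_convexHull_of_exists_fintype w z hw.1 hw.2 (fun i => hz i trivial) rfl

/-- The lower convex envelope at `p` of a continuous function on the face of the simplex spanned
by the support of `p`: the envelope is attained, and it has a supporting affine function. -/
lemma exists_lower_envelope {X : Type*} [Fintype X] {φ : (X → ℝ) → ℝ} (hφ : Continuous φ)
    {p : X → ℝ} (hp : p ∈ stdSimplex ℝ X) :
    ∃ (A : ℝ) (l : X → ℝ), ∑ x, p x * l x = 0 ∧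
      (∀ v ∈ stdSimplex ℝ X, (∀ x, p x = 0 → v x = 0) → A + ∑ x, v x * l x ≤ φ v) ∧
      ∃ (k : ℕ) (w : Fin k → ℝ) (z : Fin k → X → ℝ), w ∈ stdSimplex ℝ (Fin k) ∧
        (∀ i, z i ∈ stdSimplex ℝ X) ∧ (∀ i x, p x = 0 → z i x = 0) ∧
        (∀ x, ∑ i, w i * z i x = p x) ∧ ∑ i, w i * φ (z i) = A := by
  classical
  set K : Set (X → ℝ) := {v | v ∈ stdSimplex ℝ X ∧ ∀ x, p x = 0 → v x = 0} with hK
  have hKc : IsCompact K := by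
    refine (isCompact_stdSimplex ℝ X).inter_right (t := {v | ∀ x, p x = 0 → v x = 0}) ?_
    simp only [Set.ofPred_forall]
    exact isClosed_iInter fun x => isClosed_iInter fun _ =>
      isClosed_eq (continuous_apply x) continuous_const
  have hpK : p ∈ K := ⟨hp, fun _ h => h⟩
  set C := convexHull ℝ ((fun v => (v, φ v)) '' K) with hC
  have hCc : IsCompact C :=
    isCompact_convexHull_of_finiteDimensional (hKc.image (by fun_prop))
  have hmem : ∀ v ∈ K, (v, φ v) ∈ C := fun v hv => subset_convexHull _ _ ⟨v, hv, rfl⟩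
  -- the lowest point of the convex hull of the graph above `p`
  obtain ⟨⟨p', A⟩, ⟨hAC, hp'⟩, hAmin⟩ :=
    (hCc.inter_right (t := {t : (X → ℝ) × ℝ | t.1 = p})
      (isClosed_eq continuous_fst continuous_const)).exists_isMinOn
      ⟨(p, φ p), hmem p hpK, rfl⟩ continuous_snd.continuousOn
  obtain rfl : p' = p := hp'
  have hmin : ∀ t, (p', t) ∈ C → A ≤ t := fun t ht => hAmin ⟨ht, rfl⟩
  obtain ⟨B, hB⟩ := hKc.exists_bound_of_continuousOn hφ.continuousOn
  set B' := B + |A| + 1 with hB'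
  have hB0 : 0 ≤ B := (norm_nonneg _).trans (hB _ hpK)
  have hB'0 : 0 ≤ B' := by positivity
  -- the supporting functionals at height `A - ε` stay in a compact box
  have hsep : ∀ ε : ℝ, 0 < ε → ε ≤ 1 → ∃ l : X → ℝ,
      l ∈ Set.Icc (fun x => if p' x = 0 then 0 else -B' / p' x) (fun _ => B') ∧
      ∑ x, p' x * l x = 0 ∧ ∀ v ∈ K, A - ε + ∑ x, v x * l x ≤ φ v := by
    intro ε hε hε1
    obtain ⟨f, u, hfu, hf⟩ := geometric_hahn_banach_point_closed (x := (p', A - ε))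
      (convex_convexHull ℝ _) hCc.isClosed fun h => by
        have := hmin _ h
        linarith
    set τ := f (0, 1) with hτ
    have hfe : ∀ v t, f (v, t) = ∑ x, v x * f (Pi.single x 1, 0) + t * τ := by
      intro v t
      have h1 : (v, t) = ∑ x, v x • ((Pi.single x 1 : X → ℝ), (0 : ℝ)) +
          t • ((0 : X → ℝ), (1 : ℝ)) := by
        ext x
        · simp [Prod.fst_sum, Finset.sum_apply, Pi.single_apply]
        · simp [Prod.snd_sum]
      rw [h1, map_add, map_sum]
      simp only [map_smul, smul_eq_mul, hτ]
    have hτ0 : 0 < τ := by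
      have h1 := hf _ hAC
      have h2 := hfu.trans h1
      rw [hfe, hfe] at h2
      nlinarith
    set l₀ : X → ℝ := fun x => -f (Pi.single x 1, 0) / τ with hl₀
    have hsum : ∀ v : X → ℝ, ∑ x, v x * f (Pi.single x 1, 0) = -τ * ∑ x, v x * l₀ x := by
      intro v
      rw [Finset.mul_sum]
      refine Finset.sum_congr rfl fun x _ => ?_
      simp only [hl₀]
      field_simp
    have hsup : ∀ v ∈ K, A - ε + (∑ x, v x * l₀ x - ∑ x, p' x * l₀ x) ≤ φ v := by
      intro v hv
      have h2 := hfu.trans (hf _ (hmem v hv))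
      rw [hfe, hfe, hsum, hsum] at h2
      have h3 : τ * (A - ε + (∑ x, v x * l₀ x - ∑ x, p' x * l₀ x)) ≤ τ * φ v := by linarith
      exact le_of_mul_le_mul_left h3 hτ0
    set l : X → ℝ := fun x => if p' x = 0 then 0 else l₀ x - ∑ x, p' x * l₀ x with hl
    have hlv : ∀ v ∈ K, ∑ x, v x * l x = ∑ x, v x * l₀ x - ∑ x, p' x * l₀ x := by
      intro v hv
      have h1 : ∀ x, v x * l x = v x * l₀ x - v x * ∑ x, p' x * l₀ x := by
        intro x
        by_cases h0 : p' x = 0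
        · simp [hv.2 x h0]
        · simp [hl, h0, mul_sub]
      simp only [h1, Finset.sum_sub_distrib, ← Finset.sum_mul, hv.1.2, one_mul]
    have hlK : ∀ v ∈ K, A - ε + ∑ x, v x * l x ≤ φ v := fun v hv => by
      rw [hlv v hv]; exact hsup v hv
    have hl0 : ∑ x, p' x * l x = 0 := by rw [hlv p' hpK, sub_self]
    have hub : ∀ x, l x ≤ B' := by
      intro x
      by_cases h0 : p' x = 0
      · simpa [hl, h0] using hB'0
      have hx : Pi.single x 1 ∈ K := ⟨single_mem_stdSimplex ℝ x, fun x' hx' => by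
        rw [Pi.single_apply, if_neg]
        rintro rfl
        exact h0 hx'⟩
      have h1 := hlK _ hx
      have h2 := (le_abs_self _).trans (hB _ hx)
      have h3 : ∑ x', (Pi.single x 1 : X → ℝ) x' * l x' = l x := by
        simp [Pi.single_apply]
      rw [h3] at h1
      have := neg_abs_le A
      linarith
    refine ⟨l, ⟨fun x => ?_, hub⟩, hl0, hlK⟩
    by_cases h0 : p' x = 0
    · simp [hl, h0]
    · have hpx : 0 < p' x := lt_of_le_of_ne (hp.1 x) (Ne.symm h0)
      simp only [h0, if_false]
      rw [div_le_iff₀ hpx, mul_comm]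
      have h1 : ∑ x' ∈ Finset.univ.erase x, p' x' * l x' ≤ ∑ x', p' x' * B' :=
        (Finset.sum_le_sum fun x' _ => mul_le_mul_of_nonneg_left (hub x') (hp.1 x')).trans
          (Finset.sum_le_sum_of_subset_of_nonneg (Finset.subset_univ _)
            fun x' _ _ => mul_nonneg (hp.1 x') hB'0)
      rw [← Finset.sum_mul, hp.2] at h1
      rw [← Finset.add_sum_erase _ _ (Finset.mem_univ x)] at hl0
      linarith
  -- let `ε` tend to zero
  have hpos : ∀ m : ℕ, (0 : ℝ) < 1 / ((m : ℝ) + 1) := fun m => Nat.one_div_pos_of_nat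
  choose l hlbox hl0 hlK using fun m : ℕ => hsep (1 / ((m : ℝ) + 1)) (hpos m)
    ((div_le_one (by positivity)).2 (by linarith [m.cast_nonneg (α := ℝ)]))
  obtain ⟨l', -, ψ, hψ, hlim⟩ := isCompact_Icc.tendsto_subseq hlbox
  have hlim' : ∀ v : X → ℝ, Tendsto (fun m => ∑ x, v x * l (ψ m) x) atTop
      (𝓝 (∑ x, v x * l' x)) := fun v =>
    tendsto_finsetSum _ fun x _ => (tendsto_pi_nhds.1 hlim x).const_mul _
  refine ⟨A, l', tendsto_nhds_unique (hlim' p') (by simp [hl0]), fun v hv hv0 => ?_, ?_⟩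
  · have h1 : Tendsto (fun m => A - 1 / ((ψ m : ℕ) + 1 : ℝ) + ∑ x, v x * l (ψ m) x) atTop
        (𝓝 (A - 0 + ∑ x, v x * l' x)) :=
      (tendsto_const_nhds.sub
        (tendsto_one_div_add_atTop_nhds_zero_nat.comp hψ.tendsto_atTop)).add (hlim' v)
    rw [sub_zero] at h1
    exact le_of_tendsto' h1 fun m => hlK (ψ m) v ⟨hv, hv0⟩
  · obtain ⟨ι, _, w, z, hw0, hw1, hz, hsum⟩ := mem_convexHull_iff_exists_fintype.1 hAC
    choose z' hz' hzz using hz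
    let e := (Fintype.equivFin ι).symm
    have hs1 := congrArg Prod.fst hsum
    have hs2 := congrArg Prod.snd hsum
    simp only [← hzz, Prod.fst_sum, Prod.snd_sum, Prod.smul_fst, Prod.smul_snd, smul_eq_mul]
      at hs1 hs2
    refine ⟨Fintype.card ι, w ∘ e, z' ∘ e, ⟨fun i => hw0 _, ?_⟩, fun i => (hz' _).1,
      fun i => (hz' _).2, fun x => ?_, ?_⟩
    · rw [← hw1]; exact e.sum_comp w
    · rw [← congrFun hs1 x, Finset.sum_apply]
      exact e.sum_comp fun i => w i * z' i x
    · rw [← hs2]; exact e.sum_comp fun i => w i * φ (z' i)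

end ConvexHull

/-! ### The single-letter optimisation problem -/

section SingleLetter

variable {X Y : Type*} [Fintype X] [Fintype Y] {p : X × Y → ℝ}

/-- The output of the channel `p(y | x)` for the input mass function `v`. Where `p_X(x) = 0`, the
channel is the zero row. -/
def push (p : X × Y → ℝ) (v : X → ℝ) (y : Y) : ℝ :=
  ∑ x, v x * (p (x, y) / law p (fun t => t.1) x)

/-- The functional `b D(v ‖ p_X) - c D(v p_{Y|X} ‖ p_Y)` of an input distribution `v`, extended
to unnormalised `v` so that it is homogeneous of degree one. -/
def infoFn (p : X × Y → ℝ) (b c : ℝ) (v : X → ℝ) : ℝ :=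
  b * (negMulLog (∑ x, v x) - ∑ x, negMulLog (v x) - ∑ x, v x * log (law p (fun t => t.1) x))
    - c * (negMulLog (∑ x, v x) - ∑ y, negMulLog (push p v y)
      - ∑ y, push p v y * log (law p (fun t => t.2) y))

lemma continuous_infoFn (p : X × Y → ℝ) (b c : ℝ) : Continuous (infoFn p b c) := by
  unfold infoFn push
  have h : ∀ {f : (X → ℝ) → ℝ}, Continuous f → Continuous fun v => negMulLog (f v) :=
    fun hf => continuous_negMulLog.comp hf
  refine Continuous.sub (continuous_const.mul ?_) (continuous_const.mul ?_) <;>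
  refine Continuous.sub (Continuous.sub (h (by fun_prop))
    (continuous_finsetSum _ fun _ _ => h (by fun_prop))) (by fun_prop)

lemma eq_zero_of_law_fst_eq_zero (hp : ∀ t, 0 ≤ p t) {x : X} (h : law p (fun t => t.1) x = 0)
    (y : Y) : p (x, y) = 0 :=
  le_antisymm (h ▸ le_law hp (fun t => t.1) (x, y)) (hp _)

lemma sum_div_law_fst {x : X} (h : law p (fun t => t.1) x ≠ 0) :
    ∑ y, p (x, y) / law p (fun t => t.1) x = 1 := by
  rw [← Finset.sum_div, ← law_fst_eq_sum, div_self h]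

lemma push_nonneg (hp : ∀ t, 0 ≤ p t) {v : X → ℝ} (hv : ∀ x, 0 ≤ v x) (y : Y) :
    0 ≤ push p v y :=
  Finset.sum_nonneg fun x _ => mul_nonneg (hv x) (div_nonneg (hp _) (law_nonneg hp _ _))

lemma sum_push {v : X → ℝ} (hv : ∀ x, law p (fun t => t.1) x = 0 → v x = 0) :
    ∑ y, push p v y = ∑ x, v x := by
  unfold push
  rw [Finset.sum_comm]
  refine Finset.sum_congr rfl fun x _ => ?_
  rw [← Finset.mul_sum]
  by_cases h : law p (fun t => t.1) x = 0
  · simp [hv x h]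
  · rw [sum_div_law_fst h, mul_one]

lemma push_smul (t : ℝ) (v : X → ℝ) (y : Y) : push p (fun x => t * v x) y = t * push p v y := by
  simp only [push, Finset.mul_sum, mul_assoc]

lemma infoFn_smul (b c t : ℝ) {v : X → ℝ} (hv : ∀ x, law p (fun t => t.1) x = 0 → v x = 0) :
    infoFn p b c (fun x => t * v x) = t * infoFn p b c v := by
  unfold infoFn
  simp only [push_smul, negMulLog_mul, Finset.sum_add_distrib, ← Finset.mul_sum, mul_assoc,
    ← Finset.sum_mul, sum_push hv]
  ring

/-- For a Markov chain `f - g - h` with `(g, h) ∼ p`, the weighted information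
`b I(f; g) - c I(f; h)` is the sum of `infoFn` over the values of `f`. -/
lemma mutualInfo_eq_sum_infoFn {Ω U : Type*} [Fintype Ω] [Fintype U] {q : Ω → ℝ}
    (hq : ∀ ω, 0 ≤ q ω) (b c : ℝ) (f : Ω → U) (g : Ω → X) (h : Ω → Y)
    (hM : IsMarkovChain q f g h) (hgh : law q (fun ω => (g ω, h ω)) = p) :
    b * mutualInfo q f g - c * mutualInfo q f h =
      ∑ u, infoFn p b c (fun x => law q (fun ω => (f ω, g ω)) (u, x)) := by
  have hg : ∀ x, law p (fun t => t.1) x = law q g x := fun x => by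
    rw [← hgh, ← law_comp]
  have hh : ∀ y, law p (fun t => t.2) y = law q h y := fun x => by
    rw [← hgh, ← law_comp]
  have hmass : ∀ u, ∑ x, law q (fun ω => (f ω, g ω)) (u, x) = law q f u := fun u =>
    (law_eq_sum_pair_left q f g u).symm
  have hpush : ∀ u y, push p (fun x => law q (fun ω => (f ω, g ω)) (u, x)) y =
      law q (fun ω => (f ω, h ω)) (u, y) := by
    intro u y
    have h1 : law q (fun ω => (f ω, h ω)) (u, y) =
        ∑ x, law q (fun ω => (f ω, g ω, h ω)) (u, x, y) := by
      rw [law_eq_sum_pair_right q g (fun ω => (f ω, h ω))]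
      exact Finset.sum_congr rfl fun x _ => law_congr_of_iff q fun ω => by
        simp only [Prod.mk.injEq]; tauto
    rw [h1, push]
    refine Finset.sum_congr rfl fun x _ => ?_
    have h2 := hM u x y
    rw [hgh, ← hg] at h2
    by_cases h0 : law p (fun t => t.1) x = 0
    · have h3 : law q (fun ω => (f ω, g ω, h ω)) (u, x, y) ≤ law q g x :=
        law_le_of_imp hq fun ω h => by simp only [Prod.mk.injEq] at h; exact h.2.1
      rw [← hg, h0] at h3
      rw [h0, div_zero, mul_zero]
      exact (le_antisymm h3 (law_nonneg hq _ _)).symm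
    · rw [← mul_div_assoc, ← h2, mul_div_cancel_right₀ _ h0]
  have e1 : ∑ u, ∑ x, law q (fun ω => (f ω, g ω)) (u, x) * log (law p (fun t => t.1) x) =
      -ent q g := by
    rw [Finset.sum_comm]
    simp only [← Finset.sum_mul, ← law_eq_sum_pair_right, hg, ent_eq_sum_negMulLog, negMulLog,
      ← Finset.sum_neg_distrib]
    simp
  have e2 : ∑ u, ∑ y, law q (fun ω => (f ω, h ω)) (u, y) * log (law p (fun t => t.2) y) =
      -ent q h := by
    rw [Finset.sum_comm]
    simp only [← Finset.sum_mul, ← law_eq_sum_pair_right, hh, ent_eq_sum_negMulLog, negMulLog,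
      ← Finset.sum_neg_distrib]
    simp
  rw [mutualInfo_eq_ent hq, mutualInfo_eq_ent hq]
  simp only [infoFn, hmass, hpush, Finset.sum_sub_distrib, ← Finset.mul_sum, e1, e2]
  simp only [ent_eq_sum_negMulLog, Fintype.sum_prod_type]
  ring

/-- The affine function `v ↦ A + ∑ v l` bounds `infoFn p b c` from below on the probability
distributions absolutely continuous with respect to `p_X`, and its value at `p_X` is `A`. The
bound is stated in homogeneous form, for unnormalised `v`. -/
structure IsAffineMinorant (p : X × Y → ℝ) (b c A : ℝ) (l : X → ℝ) : Prop where
  centred : ∑ x, law p (fun t => t.1) x * l x = 0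
  le_infoFn : ∀ v : X → ℝ, (∀ x, 0 ≤ v x) → (∀ x, law p (fun t => t.1) x = 0 → v x = 0) →
    A * ∑ x, v x + ∑ x, v x * l x ≤ infoFn p b c v

/-- Let `A` be the lower convex envelope of `infoFn` at `p_X`. Then `A` is the least value of
`b I(U; X) - c I(U; Y)` over the Markov chains `U - X - Y` with `(X, Y) ∼ p`, it is attained by a
finite channel `a` from `X` to `U`, and `infoFn` has a supporting affine function there. -/
theorem exists_infoFn_envelope (hp : p ∈ stdSimplex ℝ (X × Y)) (b c : ℝ) :
    ∃ (A : ℝ) (l : X → ℝ), IsAffineMinorant p b c A l ∧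
      ∃ (k : ℕ) (a : X → Fin k → ℝ), (∀ x, a x ∈ stdSimplex ℝ (Fin k)) ∧
        ∑ u, infoFn p b c (fun x => law p (fun t => t.1) x * a x u) = A := by
  obtain ⟨A, l, hl, hA, k, w, z, hw, hz, hz0, hwz, hwA⟩ :=
    exists_lower_envelope (continuous_infoFn p b c) (law_mem_stdSimplex hp fun t => t.1)
  refine ⟨A, l, ⟨hl, fun v hv hv0 => ?_⟩, k,
    fun x u => if law p (fun t => t.1) x = 0 then w u
      else w u * z u x / law p (fun t => t.1) x, fun x => ⟨fun u => ?_, ?_⟩, ?_⟩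
  · rcases (Finset.sum_nonneg fun x _ => hv x).eq_or_lt with hs | hs
    · have h0 : ∀ x, v x = 0 := fun x =>
        (Finset.sum_eq_zero_iff_of_nonneg fun x _ => hv x).1 hs.symm x (Finset.mem_univ x)
      have h1 := infoFn_smul b c 0 hv0
      simp only [h0, mul_zero, zero_mul] at h1
      rw [show v = fun _ => 0 from funext h0, h1]
      simp
    · set s := ∑ x, v x
      have h0 : ∀ x, law p (fun t => t.1) x = 0 → s⁻¹ * v x = 0 := fun x hx => by simp [hv0 x hx]
      have h1 := hA (fun x => s⁻¹ * v x)
        ⟨fun x => mul_nonneg (inv_nonneg.2 hs.le) (hv x),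
          by rw [← Finset.mul_sum]; exact inv_mul_cancel₀ hs.ne'⟩ h0
      rw [infoFn_smul b c _ hv0] at h1
      simp only [mul_assoc, ← Finset.mul_sum] at h1
      have h2 := mul_le_mul_of_nonneg_left h1 hs.le
      rw [mul_add, ← mul_assoc, ← mul_assoc, mul_inv_cancel₀ hs.ne', one_mul, one_mul] at h2
      linarith
  · have := hw.1 u
    have := (hz u).1 x
    have := law_nonneg hp.1 (fun t => t.1) x
    dsimp only
    split_ifs <;> positivity
  · dsimp only
    split_ifs with h
    · exact hw.2
    · rw [← Finset.sum_div, hwz, div_self h]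
  · rw [← hwA]
    refine Finset.sum_congr rfl fun u _ => ?_
    rw [← infoFn_smul b c (w u) (hz0 u)]
    congr 1
    funext x
    dsimp only
    split_ifs with h
    · simp [h, hz0 u x h]
    · rw [mul_div_cancel₀ _ h]

end SingleLetter

/-! ### Entropy continuity and Hellinger distance -/

section Continuity

/-- `t ↦ -t log t` is Hölder continuous of exponent `1/2` on the unit interval. -/
lemma abs_negMulLog_sub_le {x y : ℝ} (hx : x ∈ Set.Icc (0 : ℝ) 1) (hy : y ∈ Set.Icc (0 : ℝ) 1) :
    |negMulLog x - negMulLog y| ≤ 2 * √|x - y| := by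
  wlog hxy : x ≤ y generalizing x y
  · rw [abs_sub_comm, abs_sub_comm x]
    exact this hy hx (le_of_not_ge hxy)
  rcases hxy.eq_or_lt with rfl | hlt
  · simp
  have hh : 0 < y - x := sub_pos.2 hlt
  have hy0 : 0 < y := hx.1.trans_lt hlt
  rw [abs_sub_comm x, abs_of_pos hh]
  have hs : 0 < √(y - x) := sqrt_pos.2 hh
  have hss : √(y - x) * √(y - x) = y - x := mul_self_sqrt hh.le
  have hs1 : √(y - x) ≤ 1 := by
    rw [sqrt_le_left (by norm_num)]
    linarith [hy.2, hx.1]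
  have hly : log y ≤ 0 := log_nonpos hy0.le hy.2
  rw [abs_le]
  constructor
  · -- here `x log x ≤ x log y`, and `-(y - x) log y ≤ -h log h` for `h = y - x`
    have h1 : x * log x ≤ x * log y := by
      rcases hx.1.eq_or_lt with h0 | h0
      · simp [← h0]
      · exact mul_le_mul_of_nonneg_left (log_le_log h0 hxy) hx.1
    have h2 : log (y - x) ≤ log y := log_le_log hh (by linarith [hx.1])
    have h3 : log (√(y - x)) = log (y - x) / 2 := log_sqrt hh.le
    have h4 := log_le_sub_one_of_pos (inv_pos.2 hs)
    rw [log_inv, h3] at h4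
    have h5 : (y - x) * (√(y - x))⁻¹ = √(y - x) := by
      field_simp
      nlinarith
    have h6 := mul_le_mul_of_nonneg_left h4 hh.le
    have h7 := mul_le_mul_of_nonneg_left h2 hh.le
    rw [mul_sub, h5] at h6
    simp only [negMulLog]
    nlinarith
  · have h1 := sub_le_mul_log_sub hx.1 hy0.le fun h0 => absurd h0 hy0.ne'
    have h2 := mul_nonpos_of_nonneg_of_nonpos hh.le hly
    have h3 := mul_le_mul_of_nonneg_left hs1 hs.le
    simp only [negMulLog]
    linarith

/-- The relative entropy dominates the squared Hellinger distance, and hence the square of each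
difference of probabilities. -/
lemma sq_sub_le_relEnt {ι : Type*} [Fintype ι] {v m : ι → ℝ} (hv : v ∈ stdSimplex ℝ ι)
    (hm : m ∈ stdSimplex ℝ ι) (h0 : ∀ i, m i = 0 → v i = 0) (i : ι) :
    (v i - m i) ^ 2 ≤ 4 * ∑ j, (v j * log (v j) - v j * log (m j)) := by
  have hpt : ∀ j, v j - m j + (√(v j) - √(m j)) ^ 2 ≤ v j * log (v j) - v j * log (m j) := by
    intro j
    have h1 := sub_le_mul_log_sub (sqrt_nonneg (v j)) (sqrt_nonneg (m j)) fun h => by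
      rw [sqrt_eq_zero (hm.1 j)] at h
      rw [h0 j h, sqrt_zero]
    have h2 := mul_le_mul_of_nonneg_left h1 (sqrt_nonneg (v j))
    rw [log_sqrt (hv.1 j), log_sqrt (hm.1 j)] at h2
    have h3 := mul_self_sqrt (hv.1 j)
    have h4 := mul_self_sqrt (hm.1 j)
    have h5 : √(v j) * (√(v j) * (log (v j) / 2) - √(v j) * (log (m j) / 2)) =
        v j * (log (v j) / 2) - v j * (log (m j) / 2) := by
      rw [mul_sub, ← mul_assoc, ← mul_assoc, h3]
    rw [h5] at h2
    nlinarith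
  have hsum : ∑ j, (√(v j) - √(m j)) ^ 2 ≤ ∑ j, (v j * log (v j) - v j * log (m j)) := by
    have := Finset.sum_le_sum fun j (_ : j ∈ Finset.univ) => hpt j
    rw [Finset.sum_add_distrib, Finset.sum_sub_distrib, hv.2, hm.2] at this
    linarith
  have hi := Finset.single_le_sum (f := fun j => (√(v j) - √(m j)) ^ 2)
    (fun j _ => sq_nonneg _) (Finset.mem_univ i)
  have e : (v i - m i) ^ 2 = (√(v i) - √(m i)) ^ 2 * (√(v i) + √(m i)) ^ 2 := by
    rw [← mul_pow]
    congr 1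
    linear_combination -mul_self_sqrt (hv.1 i) + mul_self_sqrt (hm.1 i)
  have hle : ∀ {u : ι → ℝ}, u ∈ stdSimplex ℝ ι → √(u i) ≤ 1 := fun {u} hu => by
    rw [sqrt_le_left (by norm_num), one_pow, ← hu.2]
    exact Finset.single_le_sum (fun j _ => hu.1 j) (Finset.mem_univ i)
  have h4 : (√(v i) + √(m i)) ^ 2 ≤ 4 := by
    nlinarith [hle hv, hle hm, sqrt_nonneg (v i), sqrt_nonneg (m i)]
  rw [e]
  nlinarith [sq_nonneg (√(v i) - √(m i))]

end Continuity

/-! ### The single-letter bound for arbitrary couplings -/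

section Robust

variable {X Y : Type*} [Fintype X] [Fintype Y] {p : X × Y → ℝ}

/-- The difference of `D(· ‖ p_Y)` between the output distribution of the channel and the actual
second marginal of `v` is controlled by the relative entropy `D(v ‖ v_X p_{Y|X})`. -/
lemma exists_push_continuity (hp : p ∈ stdSimplex ℝ (X × Y)) :
    ∃ K : ℝ, 0 ≤ K ∧ ∀ v ∈ stdSimplex ℝ (X × Y), (∀ t, p t = 0 → v t = 0) →
      0 ≤ ∑ t, (v t * log (v t) -
          v t * log (law v (fun t => t.1) t.1 * (p t / law p (fun t => t.1) t.1))) ∧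
      ∑ y, (negMulLog (push p (law v fun t => t.1) y) - negMulLog (law v (fun t => t.2) y) +
        (push p (law v fun t => t.1) y - law v (fun t => t.2) y) *
          log (law p (fun t => t.2) y)) ≤
      K * √√(∑ t, (v t * log (v t) -
          v t * log (law v (fun t => t.1) t.1 * (p t / law p (fun t => t.1) t.1)))) := by
  set L := ∑ y, |log (law p (fun t => t.2) y)| with hL
  have hL0 : 0 ≤ L := Finset.sum_nonneg fun _ _ => abs_nonneg _
  refine ⟨Fintype.card Y * ((2 + L) * √(2 * Fintype.card X)), by positivity, fun v hv hv0 => ?_⟩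
  set vX := law v (fun t => t.1) with hvX
  set pX := law p (fun t => t.1) with hpX
  have hv0' : ∀ x, pX x = 0 → vX x = 0 := fun x hx => by
    rw [hvX, law_fst_eq_sum]
    exact Finset.sum_eq_zero fun y _ => hv0 _ (eq_zero_of_law_fst_eq_zero hp.1 hx y)
  set m : X × Y → ℝ := fun t => vX t.1 * (p t / pX t.1) with hm
  have hmS : m ∈ stdSimplex ℝ (X × Y) := by
    refine ⟨fun t => mul_nonneg (law_nonneg hv.1 _ _)
      (div_nonneg (hp.1 _) (law_nonneg hp.1 _ _)), ?_⟩
    rw [Fintype.sum_prod_type_right]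
    have h := sum_push hv0'
    rw [hvX, sum_law, hv.2] at h
    exact h
  have hm0 : ∀ t, m t = 0 → v t = 0 := by
    rintro ⟨x, y⟩ h
    simp only [hm, mul_eq_zero, div_eq_zero_iff] at h
    rcases h with h | h | h
    · exact eq_zero_of_law_fst_eq_zero hv.1 h y
    · exact hv0 _ h
    · exact hv0 _ (eq_zero_of_law_fst_eq_zero hp.1 h y)
  have hH := sq_sub_le_relEnt hv hmS hm0
  set t := ∑ s, (v s * log (v s) - v s * log (m s)) with ht
  have ht0 : 0 ≤ t := by
    obtain ⟨s, -⟩ := exists_ne_zero_of_mem_stdSimplex hv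
    nlinarith [hH s, sq_nonneg (v s - m s)]
  refine ⟨ht0, ?_⟩
  have hd : ∀ y, |push p vX y - law v (fun t => t.2) y| ≤ Fintype.card X * (2 * √t) := by
    intro y
    have e : push p vX y - law v (fun t => t.2) y = ∑ x, (m (x, y) - v (x, y)) := by
      rw [Finset.sum_sub_distrib, law_snd_eq_sum]
      rfl
    rw [e]
    refine (Finset.abs_sum_le_sum_abs _ _).trans ?_
    rw [← nsmul_eq_mul, ← Finset.card_univ]
    refine Finset.sum_le_card_nsmul _ _ _ fun x _ => ?_
    rw [abs_sub_comm]
    refine abs_le_of_sq_le_sq ?_ (by positivity)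
    rw [mul_pow, sq_sqrt ht0]
    linarith [hH (x, y)]
  have hunit : ∀ {u : Y → ℝ}, (∀ y, 0 ≤ u y) → ∑ y, u y = 1 → ∀ y, u y ∈ Set.Icc (0 : ℝ) 1 :=
    fun {u} h0 h1 y => ⟨h0 y, h1 ▸ Finset.single_le_sum (fun j _ => h0 j) (Finset.mem_univ y)⟩
  have hr := hunit (push_nonneg hp.1 (law_nonneg hv.1 _))
    (by rw [sum_push hv0', hvX, sum_law, hv.2])
  have hy := hunit (law_nonneg hv.1 fun t : X × Y => t.2) (by rw [sum_law, hv.2])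
  rw [mul_assoc, ← nsmul_eq_mul, ← Finset.card_univ]
  refine Finset.sum_le_card_nsmul _ _ _ fun y _ => ?_
  set δ := |push p vX y - law v (fun t => t.2) y| with hδ
  have hδ0 : 0 ≤ δ := abs_nonneg _
  have hδ1 : δ ≤ 1 := abs_le.2 ⟨by linarith [(hr y).1, (hy y).2], by linarith [(hr y).2, (hy y).1]⟩
  have hδs : δ ≤ √δ := by
    rw [le_sqrt hδ0 hδ0]
    nlinarith
  have h1 := (le_abs_self _).trans (abs_negMulLog_sub_le (hr y) (hy y))
  have h2 : (push p vX y - law v (fun t => t.2) y) * log (law p (fun t => t.2) y) ≤ √δ * L := by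
    refine (le_abs_self _).trans ?_
    rw [abs_mul]
    exact mul_le_mul hδs (Finset.single_le_sum
      (f := fun y => |log (law p (fun t => t.2) y)|) (fun _ _ => abs_nonneg _)
      (Finset.mem_univ y)) (abs_nonneg _) (sqrt_nonneg _)
  have h3 : √δ ≤ √(2 * Fintype.card X) * √√t := by
    rw [← sqrt_mul (by positivity)]
    refine sqrt_le_sqrt ?_
    linarith [hd y]
  nlinarith

/-- The single-letter entropy combination that tensorizes,
`-α H(XY) + (α - b) H(X) + c H(Y)` plus the integral of the potential `w`, for a joint mass
function `v`. The term with the total mass makes it homogeneous of degree one in `v`. -/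
def entropyFunctional (α b c : ℝ) (w v : X × Y → ℝ) : ℝ :=
  -(α * ∑ t, negMulLog (v t)) + (α - b) * ∑ x, negMulLog (law v (fun t => t.1) x) +
    c * ∑ y, negMulLog (law v (fun t => t.2) y) + (b - c) * negMulLog (∑ t, v t) +
    ∑ t, v t * w t

/-- The potential that turns `entropyFunctional` into
`α D(v ‖ v_X p_{Y|X}) + b D(v_X ‖ p_X) - c D(v_Y ‖ p_Y) - E_v l - g` for a probability
distribution `v`. -/
def potential (p : X × Y → ℝ) (α b c : ℝ) (l : X → ℝ) (g : ℝ) (t : X × Y) : ℝ :=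
  -(α * log (p t)) + (α - b) * log (law p (fun t => t.1) t.1) +
    c * log (law p (fun t => t.2) t.2) - l t.1 - g

/-- The affine lower bound for `b D(v_X ‖ p_X) - c D(v_X p_{Y|X} ‖ p_Y)` survives, up to
`K / a`, when the output of the channel is replaced by an arbitrary coupling `v`, provided the
deviation of `v` from the channel is penalised with weight at least `a ^ 3`. -/
lemma exists_entropyFunctional_nonneg (hp : p ∈ stdSimplex ℝ (X × Y)) {b c A : ℝ} (hb : 0 ≤ b)
    (hc : 0 ≤ c) {l : X → ℝ} (hA : IsAffineMinorant p b c A l) :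
    ∃ K : ℝ, 0 ≤ K ∧ ∀ a : ℝ, 0 < a → ∀ v : X × Y → ℝ, (∀ t, 0 ≤ v t) →
      (∀ t, p t = 0 → v t = 0) →
      0 ≤ entropyFunctional (a ^ 3 + b) b c (potential p (a ^ 3 + b) b c l (A - K / a)) v := by
  obtain ⟨K, hK, h⟩ := exists_push_continuity hp
  refine ⟨c * K * (c * K + 1), by positivity, fun a ha => ?_⟩
  -- the case of a probability distribution
  have hprob : ∀ v ∈ stdSimplex ℝ (X × Y), (∀ t, p t = 0 → v t = 0) →
      0 ≤ -((a ^ 3 + b) * ∑ t, negMulLog (v t)) +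
        a ^ 3 * ∑ x, negMulLog (law v (fun t => t.1) x) +
        c * ∑ y, negMulLog (law v (fun t => t.2) y) +
        ∑ t, v t * potential p (a ^ 3 + b) b c l (A - c * K * (c * K + 1) / a) t := by
    intro v hv hv0
    obtain ⟨ht0, hcont⟩ := h v hv hv0
    set t := ∑ t, (v t * log (v t) -
          v t * log (law v (fun t => t.1) t.1 * (p t / law p (fun t => t.1) t.1))) with ht
    have hv0' : ∀ x, law p (fun t => t.1) x = 0 → law v (fun t => t.1) x = 0 := fun x hx => by
      rw [law_fst_eq_sum]
      exact Finset.sum_eq_zero fun y _ => hv0 _ (eq_zero_of_law_fst_eq_zero hp.1 hx y)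
    have hAv := hA.le_infoFn _ (law_nonneg hv.1 fun t => t.1) hv0'
    have hmass : ∑ x, law v (fun t => t.1) x = 1 := by rw [sum_law, hv.2]
    -- the penalty term in terms of entropies
    have ht' : t = -∑ t, negMulLog (v t) + ∑ x, negMulLog (law v (fun t => t.1) x) -
        ∑ t, v t * log (p t) + ∑ t, v t * log (law p (fun t => t.1) t.1) := by
      have e : ∑ x, negMulLog (law v (fun t => t.1) x) =
          -∑ t, v t * log (law v (fun t => t.1) t.1) := by
        rw [← sum_law_mul v (fun t => t.1) fun x => log (law v (fun t => t.1) x),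
          ← Finset.sum_neg_distrib]
        simp [negMulLog]
      rw [e, ht, ← Finset.sum_neg_distrib, ← Finset.sum_neg_distrib, ← Finset.sum_add_distrib,
        ← Finset.sum_sub_distrib, ← Finset.sum_add_distrib]
      refine Finset.sum_congr rfl fun s _ => ?_
      by_cases h0 : v s = 0
      · simp [h0]
      · have h1 := law_pos hv.1 (fun t => t.1) h0
        have hps : p s ≠ 0 := fun h => h0 (hv0 s h)
        have h2 := law_pos hp.1 (fun t => t.1) hps
        rw [log_mul h1.ne' (div_ne_zero hps h2.ne'), log_div hps h2.ne', negMulLog]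
        ring
    have hpot : ∑ t, v t * potential p (a ^ 3 + b) b c l (A - c * K * (c * K + 1) / a) t =
        -((a ^ 3 + b) * ∑ t, v t * log (p t)) +
          a ^ 3 * ∑ t, v t * log (law p (fun t => t.1) t.1) +
          c * ∑ t, v t * log (law p (fun t => t.2) t.2) - ∑ t, v t * l t.1 -
          (A - c * K * (c * K + 1) / a) := by
      have e : (A - c * K * (c * K + 1) / a) = ∑ t, v t * (A - c * K * (c * K + 1) / a) := by
        rw [← Finset.sum_mul, hv.2, one_mul]
      rw [e, Finset.mul_sum, Finset.mul_sum, Finset.mul_sum, ← Finset.sum_neg_distrib,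
        ← Finset.sum_add_distrib, ← Finset.sum_add_distrib, ← Finset.sum_sub_distrib,
        ← Finset.sum_sub_distrib, ← e]
      refine Finset.sum_congr rfl fun s _ => ?_
      rw [potential]
      ring
    rw [infoFn, hmass, sum_law_mul v (fun t => t.1) l,
      sum_law_mul v (fun t => t.1) fun x => log (law p (fun t => t.1) x), negMulLog_one] at hAv
    simp only [sub_mul, Finset.sum_add_distrib, Finset.sum_sub_distrib] at hcont
    rw [sum_law_mul v (fun t => t.2) fun y => log (law p (fun t => t.2) y)] at hcont
    -- `a³ s⁴ + C (C + 1) / a ≥ C s` for `s = t ^ (1/4)` and `C = c K`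
    set s := √√t with hs
    have hs0 : 0 ≤ s := sqrt_nonneg _
    have hs4 : s ^ 4 = t := by
      rw [show s ^ 4 = (s ^ 2) ^ 2 by ring, hs, sq_sqrt (sqrt_nonneg _), sq_sqrt ht0]
    have hCs : c * K * s ≤ a ^ 3 * t + c * K * (c * K + 1) / a := by
      have hC : 0 ≤ c * K := by positivity
      set C := c * K
      rw [← hs4, ← sub_nonneg]
      have : a ^ 3 * s ^ 4 + C * (C + 1) / a - C * s =
          ((a * s) ^ 4 + C * (C + 1) - C * (a * s)) / a := by
        field_simp
      rw [this]
      refine div_nonneg ?_ ha.le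
      have hw : 0 ≤ a * s := by positivity
      set w := a * s
      rcases le_total w (C + 1) with h1 | h1
      · nlinarith [pow_nonneg hw 4]
      · have h2 : 1 ≤ w := by linarith
        have h3 : w * (w ^ 3 - w) ≥ 0 := mul_nonneg hw (by nlinarith [mul_nonneg hw hw])
        nlinarith
    have hcc := mul_le_mul_of_nonneg_left hcont hc
    rw [hpot]
    have hat : (a ^ 3 + b) * t = -((a ^ 3 + b) * ∑ t, negMulLog (v t)) +
        (a ^ 3 + b) * ∑ x, negMulLog (law v (fun t => t.1) x) -
        (a ^ 3 + b) * ∑ t, v t * log (p t) +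
        (a ^ 3 + b) * ∑ t, v t * log (law p (fun t => t.1) t.1) := by
      rw [ht']; ring
    have hbt := mul_nonneg hb ht0
    linarith
  -- the general case by homogeneity
  generalize c * K * (c * K + 1) = K' at hprob ⊢
  intro v hv hv0
  rw [entropyFunctional, add_sub_cancel_right]
  rcases (Finset.sum_nonneg fun t _ => hv t).eq_or_lt with hs | hs
  · have h0 : ∀ t, v t = 0 := fun t =>
      (Finset.sum_eq_zero_iff_of_nonneg fun t _ => hv t).1 hs.symm t (Finset.mem_univ t)
    obtain rfl : v = fun _ => 0 := funext h0
    simp [law_fst_eq_sum, law_snd_eq_sum]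
  · set s := ∑ t, v t
    set u : X × Y → ℝ := fun t => s⁻¹ * v t with hu
    have hvu : v = fun t => s * u t := by
      funext t
      rw [hu, mul_inv_cancel_left₀ hs.ne']
    have husum : ∑ t, u t = 1 := by
      rw [hu, ← Finset.mul_sum]
      exact inv_mul_cancel₀ hs.ne'
    have h1 := hprob u ⟨fun t => mul_nonneg (inv_nonneg.2 hs.le) (hv t), husum⟩
      fun t ht => by simp [hu, hv0 t ht]
    have h2 := mul_nonneg hs.le h1
    rw [hvu]
    simp only [law_const_mul, negMulLog_mul, Finset.sum_add_distrib, ← Finset.mul_sum,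
      ← Finset.sum_mul, sum_law, husum, mul_assoc]
    linarith

end Robust

/-! ### Tensorization -/

section Tensorization

variable {X Y Ω : Type*} [Fintype X] [Fintype Y] [Fintype Ω]

/-- Conditional form of a single-letter entropy inequality: it holds for `v = q_{fg}(m, ·)` for
each value `m` of a further variable `M`, and the sum over `m` is expressed through joint
entropies. -/
lemma entropyFunctional_nonneg_cond {T : Type*} [Fintype T] {s : Set (X × Y)} {α b c : ℝ}
    {w : X × Y → ℝ}
    (h : ∀ v : X × Y → ℝ, (∀ t, 0 ≤ v t) → (∀ t, t ∉ s → v t = 0) →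
      0 ≤ entropyFunctional α b c w v)
    {q : Ω → ℝ} (hq : ∀ ω, 0 ≤ q ω) (M : Ω → T) (f : Ω → X) (g : Ω → Y)
    (hs : ∀ ω, q ω ≠ 0 → (f ω, g ω) ∈ s) :
    0 ≤ -(α * ent q (fun ω => (M ω, f ω, g ω))) + (α - b) * ent q (fun ω => (M ω, f ω)) +
      c * ent q (fun ω => (M ω, g ω)) + (b - c) * ent q M + ∑ ω, q ω * w (f ω, g ω) := by
  classical
  set r := law q (fun ω => (M ω, f ω, g ω)) with hr
  have hrs : ∀ m t, t ∉ s → r (m, t) = 0 := by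
    intro m t ht
    rw [hr, law_eq_sum_ite]
    refine Finset.sum_eq_zero fun ω _ => ?_
    split_ifs with h1
    · by_contra h2
      obtain ⟨-, rfl⟩ := Prod.mk.injEq .. ▸ h1
      exact ht (hs ω h2)
    · rfl
  have hX : ∀ m x, law (fun t => r (m, t)) (fun t => t.1) x =
      law q (fun ω => (M ω, f ω)) (m, x) := by
    intro m x
    rw [law_fst_eq_sum, law_eq_sum_pair_left q (fun ω => (M ω, f ω)) g]
    exact Finset.sum_congr rfl fun y _ => law_congr_of_iff q fun ω => by
      simp only [Prod.mk.injEq]; tauto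
  have hY : ∀ m y, law (fun t => r (m, t)) (fun t => t.2) y =
      law q (fun ω => (M ω, g ω)) (m, y) := by
    intro m y
    rw [law_snd_eq_sum, law_eq_sum_pair_left q (fun ω => (M ω, g ω)) f]
    exact Finset.sum_congr rfl fun y _ => law_congr_of_iff q fun ω => by
      simp only [Prod.mk.injEq]; tauto
  have hM : ∀ m, ∑ t, r (m, t) = law q M m := fun m =>
    (law_eq_sum_pair_left q M (fun ω => (f ω, g ω)) m).symm
  have hw : ∑ m, ∑ t, r (m, t) * w t = ∑ ω, q ω * w (f ω, g ω) := by
    rw [← sum_law_mul q (fun ω => (M ω, f ω, g ω)) fun t => w t.2, Fintype.sum_prod_type]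
  have key := Finset.sum_nonneg fun m (_ : m ∈ Finset.univ) =>
    h (fun t => r (m, t)) (fun t => law_nonneg hq _ _) (hrs m)
  simp only [entropyFunctional, hX, hY, hM, Finset.sum_add_distrib, ← Finset.mul_sum,
    Finset.sum_neg_distrib, hw] at key
  simp only [ent_eq_sum_negMulLog]
  rw [Fintype.sum_prod_type, Fintype.sum_prod_type, Fintype.sum_prod_type]
  exact key

/-- Tensorization: a single-letter entropy inequality implies the same inequality for sequences
of variables, whose joint distribution is arbitrary. -/
lemma entropyFunctional_nonneg_tensor {T : Type*} [Fintype T] {s : Set (X × Y)} {α b c : ℝ}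
    (hαb : b ≤ α) (hc : 0 ≤ c) {w : X × Y → ℝ}
    (h : ∀ v : X × Y → ℝ, (∀ t, 0 ≤ v t) → (∀ t, t ∉ s → v t = 0) →
      0 ≤ entropyFunctional α b c w v)
    {q : Ω → ℝ} (hq : ∀ ω, 0 ≤ q ω) (M : Ω → T) {n : ℕ} (F : Ω → Fin n → X) (G : Ω → Fin n → Y)
    (hs : ∀ ω, q ω ≠ 0 → ∀ i, (F ω i, G ω i) ∈ s) :
    0 ≤ -(α * ent q (fun ω => (M ω, F ω, G ω))) + (α - b) * ent q (fun ω => (M ω, F ω)) +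
      c * ent q (fun ω => (M ω, G ω)) + (b - c) * ent q M +
      ∑ ω, q ω * ∑ i, w (F ω i, G ω i) := by
  induction n with
  | zero =>
    have h1 : ent q (fun ω => (M ω, F ω, G ω)) = ent q M := ent_congr q fun ω ω' => by
      simp [eq_iff_true_of_subsingleton]
    have h2 : ent q (fun ω => (M ω, F ω)) = ent q M := ent_congr q fun ω ω' => by
      simp [eq_iff_true_of_subsingleton]
    have h3 : ent q (fun ω => (M ω, G ω)) = ent q M := ent_congr q fun ω ω' => by
      simp [eq_iff_true_of_subsingleton]
    rw [h1, h2, h3]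
    simp only [Finset.univ_eq_empty, Finset.sum_empty, mul_zero, Finset.sum_const_zero, add_zero]
    exact le_of_eq (by ring)
  | succ n ih =>
    set F' : Ω → Fin n → X := fun ω i => F ω i.succ with hF'
    set G' : Ω → Fin n → Y := fun ω i => G ω i.succ with hG'
    set f : Ω → X := fun ω => F ω 0 with hf
    set g : Ω → Y := fun ω => G ω 0 with hg
    have hF : ∀ ω ω', F ω = F ω' ↔ f ω = f ω' ∧ F' ω = F' ω' := fun ω ω' => by
      simp only [funext_iff, Fin.forall_fin_succ, hf, hF']
    have hG : ∀ ω ω', G ω = G ω' ↔ g ω = g ω' ∧ G' ω = G' ω' := fun ω ω' => by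
      simp only [funext_iff, Fin.forall_fin_succ, hg, hG']
    have h1 := ih F' G' fun ω hω i => hs ω hω i.succ
    have h2 := entropyFunctional_nonneg_cond h hq (fun ω => (M ω, F' ω, G' ω)) f g
      fun ω hω => hs ω hω 0
    have h3 := ent_submodular hq (fun ω => (M ω, F' ω)) G' f
    have h4 := ent_submodular hq (fun ω => (M ω, G' ω)) F' g
    have e1 : ent q (fun ω => ((M ω, F' ω, G' ω), f ω, g ω)) =
        ent q (fun ω => (M ω, F ω, G ω)) := ent_congr q fun ω ω' => by
      simp only [Prod.mk.injEq, hF, hG]; tauto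
    have e2 : ent q (fun ω => ((M ω, F' ω), G' ω, f ω)) =
        ent q (fun ω => ((M ω, F' ω, G' ω), f ω)) := ent_congr q fun ω ω' => by
      simp only [Prod.mk.injEq]; tauto
    have e3 : ent q (fun ω => ((M ω, G' ω), F' ω, g ω)) =
        ent q (fun ω => ((M ω, F' ω, G' ω), g ω)) := ent_congr q fun ω ω' => by
      simp only [Prod.mk.injEq]; tauto
    have e4 : ent q (fun ω => ((M ω, F' ω), G' ω)) =
        ent q (fun ω => (M ω, F' ω, G' ω)) := ent_congr q fun ω ω' => by
      simp only [Prod.mk.injEq]; tauto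
    have e5 : ent q (fun ω => ((M ω, G' ω), F' ω)) =
        ent q (fun ω => (M ω, F' ω, G' ω)) := ent_congr q fun ω ω' => by
      simp only [Prod.mk.injEq]; tauto
    have e6 : ent q (fun ω => ((M ω, F' ω), f ω)) =
        ent q (fun ω => (M ω, F ω)) := ent_congr q fun ω ω' => by
      simp only [Prod.mk.injEq, hF]; tauto
    have e7 : ent q (fun ω => ((M ω, G' ω), g ω)) =
        ent q (fun ω => (M ω, G ω)) := ent_congr q fun ω ω' => by
      simp only [Prod.mk.injEq, hG]; tauto
    have hw : ∑ ω, q ω * ∑ i, w (F ω i, G ω i) =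
        ∑ ω, q ω * w (f ω, g ω) + ∑ ω, q ω * ∑ i, w (F' ω i, G' ω i) := by
      rw [← Finset.sum_add_distrib]
      exact Finset.sum_congr rfl fun ω _ => by rw [Fin.sum_univ_succ, mul_add]
    rw [e1] at h2
    rw [e2, e4, e6] at h3
    rw [e3, e5, e7] at h4
    rw [hw]
    have h5 := mul_le_mul_of_nonneg_left h3 (sub_nonneg.2 hαb)
    have h6 := mul_le_mul_of_nonneg_left h4 hc
    linarith

end Tensorization

/-! ### Memoryless sources -/

section Iid

variable {X Y Z : Type*} [Fintype X] [Fintype Y] [Fintype Z]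

/-- Under the null hypothesis, letterwise functions of the sources are i.i.d. -/
lemma law_nullLaw {A : Type*} (P : X × Y × Z → ℝ) (n : ℕ) (φ : X × Y × Z → A) (a : Fin n → A) :
    law (nullLaw P n) (fun s i => φ (s.1 i, s.2.1 i, s.2.2 i)) a = ∏ i, law P φ (a i) := by
  classical
  simp only [law_eq_sum_ite, Finset.prod_univ_sum, Fintype.piFinset_univ]
  let e : (Fin n → X × Y × Z) ≃ (Fin n → X) × (Fin n → Y) × (Fin n → Z) :=
    { toFun := fun t => (fun i => (t i).1, fun i => (t i).2.1, fun i => (t i).2.2)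
      invFun := fun s i => (s.1 i, s.2.1 i, s.2.2 i)
      left_inv := fun _ => rfl
      right_inv := fun _ => rfl }
  refine (Fintype.sum_equiv e _ _ fun t => ?_).symm
  rw [Finset.prod_ite_zero]
  simp only [e, Equiv.coe_fn_mk, funext_iff, Finset.mem_univ, true_imp_iff, nullLaw]

lemma nullLaw_mem_stdSimplex {P : X × Y × Z → ℝ} (hP : P ∈ stdSimplex ℝ (X × Y × Z)) (n : ℕ) :
    nullLaw P n ∈ stdSimplex ℝ ((Fin n → X) × (Fin n → Y) × (Fin n → Z)) := by
  refine ⟨fun s => Finset.prod_nonneg fun i _ => hP.1 _, ?_⟩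
  rw [← sum_law (nullLaw P n) (fun s i => (s.1 i, s.2.1 i, s.2.2 i))]
  simp only [law_nullLaw P n fun t => t]
  rw [← Fintype.sum_pow, sum_law, hP.2, one_pow]

lemma sum_prod_law {A : Type*} [Fintype A] {P : X × Y × Z → ℝ}
    (hP : P ∈ stdSimplex ℝ (X × Y × Z)) (n : ℕ) (φ : X × Y × Z → A) :
    ∑ a : Fin n → A, ∏ i, law P φ (a i) = 1 := by
  rw [← Fintype.sum_pow, sum_law, hP.2, one_pow]

end Iid

/-! ### The multi-letter converse for a pair of sources -/

section Change

variable {X Y : Type*} [Fintype X] [Fintype Y] {Ω : Type*} [Fintype Ω]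

/-- If `q ≤ r / δ` and `F` is i.i.d. under `r`, then the mean under `q` of the sum of a bounded
centred function of the letters is of order `√n`, by the exponential moment bound. -/
lemma sum_mul_sum_le {pX : X → ℝ} (hpX : pX ∈ stdSimplex ℝ X) {φ : X → ℝ} {B : ℝ} (hB : 0 < B)
    (hφ : ∀ x, |φ x| ≤ B) (h0 : ∑ x, pX x * φ x = 0) {δ : ℝ} (hδ : 0 < δ) {q r : Ω → ℝ}
    (hq : ∀ ω, 0 ≤ q ω) (hqr : ∀ ω, δ * q ω ≤ r ω) {n : ℕ} {F : Ω → Fin n → X}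
    (hF : ∀ x, law r F x = ∏ i, pX (x i)) {a : ℝ} (ha : 1 ≤ a) (han : (n : ℝ) ≤ a ^ 4) :
    ∑ ω, q ω * ∑ i, φ (F ω i) ≤ B * exp 1 / δ * a ^ 2 := by
  have ha0 : 0 < a := by linarith
  set θ := 1 / (B * a ^ 2) with hθ
  have hθ0 : 0 < θ := by positivity
  have hθφ : ∀ x, |θ * φ x| ≤ 1 / a ^ 2 := fun x => by
    rw [abs_mul, abs_of_pos hθ0]
    refine (mul_le_mul_of_nonneg_left (hφ x) hθ0.le).trans (le_of_eq ?_)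
    rw [hθ]
    field_simp
  have ha1 : 1 / a ^ 2 ≤ 1 := by
    rw [div_le_one (by positivity)]
    exact one_le_pow₀ ha
  have hexp : ∀ x, exp (θ * φ x) ≤ 1 + θ * φ x + 1 / a ^ 4 := fun x => by
    have h1 := (le_abs_self _).trans (abs_exp_sub_one_sub_id_le ((hθφ x).trans ha1))
    have h2 : (θ * φ x) ^ 2 ≤ (1 / a ^ 2) ^ 2 := sq_le_sq.2 (by
      rw [abs_of_nonneg (show 0 ≤ 1 / a ^ 2 by positivity)]
      exact hθφ x)
    have h3 : (1 / a ^ 2) ^ 2 = 1 / a ^ 4 := by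
      rw [div_pow, one_pow, ← pow_mul]
    linarith
  have hone : ∑ x, pX x * exp (θ * φ x) ≤ exp (1 / a ^ 4) := by
    have h1 : ∑ x, pX x * exp (θ * φ x) ≤ ∑ x, (pX x + θ * (pX x * φ x) + pX x * (1 / a ^ 4)) :=
      Finset.sum_le_sum fun x _ =>
        (mul_le_mul_of_nonneg_left (hexp x) (hpX.1 x)).trans (le_of_eq (by ring))
    rw [Finset.sum_add_distrib, Finset.sum_add_distrib, ← Finset.mul_sum, ← Finset.sum_mul, h0,
      hpX.2] at h1
    linarith [add_one_le_exp (1 / a ^ 4)]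
  have hmgf : ∑ ω, r ω * exp (θ * ∑ i, φ (F ω i)) ≤ exp 1 := by
    rw [← sum_law_mul r F fun x => exp (θ * ∑ i, φ (x i))]
    have e : ∀ x : Fin n → X, law r F x * exp (θ * ∑ i, φ (x i)) =
        ∏ i, pX (x i) * exp (θ * φ (x i)) := fun x => by
      rw [hF, Finset.mul_sum, exp_sum, Finset.prod_mul_distrib]
    simp only [e]
    rw [← Fintype.sum_pow fun x => pX x * exp (θ * φ x)]
    refine (pow_le_pow_left₀ (Finset.sum_nonneg fun x _ =>
      mul_nonneg (hpX.1 x) (exp_pos _).le) hone n).trans ?_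
    rw [← exp_nat_mul]
    refine exp_le_exp.2 ?_
    rw [mul_one_div, div_le_one (by positivity)]
    exact han
  have hmain : δ * (θ * ∑ ω, q ω * ∑ i, φ (F ω i)) ≤ exp 1 := by
    refine le_trans ?_ hmgf
    rw [Finset.mul_sum, Finset.mul_sum]
    refine Finset.sum_le_sum fun ω _ => ?_
    have h1 := add_one_le_exp (θ * ∑ i, φ (F ω i))
    have h2 : θ * ∑ i, φ (F ω i) ≤ exp (θ * ∑ i, φ (F ω i)) := by linarith
    calc δ * (θ * (q ω * ∑ i, φ (F ω i))) = δ * q ω * (θ * ∑ i, φ (F ω i)) := by ring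
      _ ≤ δ * q ω * exp (θ * ∑ i, φ (F ω i)) :=
        mul_le_mul_of_nonneg_left h2 (mul_nonneg hδ.le (hq ω))
      _ ≤ r ω * exp (θ * ∑ i, φ (F ω i)) := mul_le_mul_of_nonneg_right (hqr ω) (exp_pos _).le
  have e : B * exp 1 / δ * a ^ 2 = exp 1 / (δ * θ) := by
    rw [hθ]
    field_simp
  rw [e, le_div_iff₀ (by positivity)]
  linarith

/-- The multi-letter converse for a pair of sources. Let `q` be a change of measure of `r` with
density at most `1 / δ`, where `(F, G)` is i.i.d. under `r` with letter distribution `p`, and let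
`M` be a message for which the penalty `D(q_{MFG} ‖ q_{MF} r_{G|F})` is at most `-log δ`. Then
`b H(M) - c (I(M; G) + D(q_G ‖ r_G))` is at least `n A`, up to an error of order `n ^ (3 / 4)`. -/
theorem exists_multiletter_converse {p : X × Y → ℝ} (hp : p ∈ stdSimplex ℝ (X × Y))
    {b c A : ℝ} (hb : 0 ≤ b) (hc : 0 ≤ c) {l : X → ℝ}
    (hA : IsAffineMinorant p b c A l) {δ : ℝ} (hδ : 0 < δ) (hδ1 : δ ≤ 1) :
    ∃ C : ℝ, 0 ≤ C ∧ ∀ (n : ℕ) (a : ℝ), 1 ≤ a → (n : ℝ) ≤ a ^ 4 →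
      ∀ (Ω : Type u) (_ : Fintype Ω) (q r : Ω → ℝ), q ∈ stdSimplex ℝ Ω → (∀ ω, 0 ≤ r ω) →
      (∀ ω, δ * q ω ≤ r ω) → ∀ (F : Ω → Fin n → X) (G : Ω → Fin n → Y),
      (∀ t : Fin n → X × Y, law r (fun ω i => (F ω i, G ω i)) t = ∏ i, p (t i)) →
      (∀ x, law r F x = ∏ i, law p (fun t => t.1) (x i)) →
      (∀ y, law r G y = ∏ i, law p (fun t => t.2) (y i)) →
      ∀ (N : ℕ) (M : Ω → Fin N),
      ent q (fun ω => (M ω, F ω)) - ent q (fun ω => (M ω, F ω, G ω)) +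
        crossEnt q r (fun ω i => (F ω i, G ω i)) - crossEnt q r F ≤ -log δ →
      n * A - C * a ^ 3 ≤
        b * ent q M - c * (ent q M - ent q (fun ω => (M ω, G ω)) + crossEnt q r G) := by
  obtain ⟨K, hK, hfun⟩ := exists_entropyFunctional_nonneg hp hb hc hA
  set B := ∑ x, |l x| + 1 with hB
  have hB0 : 0 < B := by
    have : 0 ≤ ∑ x, |l x| := Finset.sum_nonneg fun _ _ => abs_nonneg _
    linarith
  have hlB : ∀ x, |-l x| ≤ B := fun x => by
    rw [abs_neg]
    have := Finset.single_le_sum (f := fun x => |l x|) (fun _ _ => abs_nonneg _)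
      (Finset.mem_univ x)
    linarith
  have hL : 0 ≤ -log δ := neg_nonneg.2 (log_nonpos hδ.le hδ1)
  refine ⟨K + (1 + 2 * b) * -log δ + B * exp 1 / δ, by positivity, ?_⟩
  intro n a ha han Ω _ q r hq hr hqr F G hFG hF hG N M hM
  have ha0 : 0 < a := by linarith
  have hqr0 : ∀ ω, q ω ≠ 0 → r ω ≠ 0 := fun ω => ne_zero_of_mul_le hδ hq.1 hqr
  -- on the support of `q`, all letter probabilities are positive
  have hsupp : ∀ ω, q ω ≠ 0 → ∀ i, p (F ω i, G ω i) ≠ 0 := fun ω h i => by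
    have h1 := (law_pos hr (fun ω i => (F ω i, G ω i)) (hqr0 ω h)).ne'
    rw [hFG] at h1
    exact Finset.prod_ne_zero_iff.1 h1 i (Finset.mem_univ i)
  have hX : ∀ ω, q ω ≠ 0 → ∀ i, law p (fun t => t.1) (F ω i) ≠ 0 := fun ω h i =>
    (law_pos hp.1 (fun t => t.1) (hsupp ω h i)).ne'
  have hY : ∀ ω, q ω ≠ 0 → ∀ i, law p (fun t => t.2) (G ω i) ≠ 0 := fun ω h i =>
    (law_pos hp.1 (fun t => t.2) (hsupp ω h i)).ne'
  have key := entropyFunctional_nonneg_tensor (s := {t | p t ≠ 0}) (α := a ^ 3 + b)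
    (le_add_of_nonneg_left (by positivity)) hc
    (fun v hv hv0 => hfun a ha0 v hv fun t ht => hv0 t (by simpa using ht)) hq.1 M F G hsupp
  have hpot : ∑ ω, q ω * ∑ i, potential p (a ^ 3 + b) b c l (A - K / a) (F ω i, G ω i) =
      (a ^ 3 + b) * crossEnt q r (fun ω i => (F ω i, G ω i)) - a ^ 3 * crossEnt q r F -
        c * crossEnt q r G + ∑ ω, q ω * ∑ i, -l (F ω i) - n * (A - K / a) := by
    have e : n * (A - K / a) = ∑ ω, q ω * (n * (A - K / a)) := by
      rw [← Finset.sum_mul, hq.2, one_mul]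
    rw [e]
    simp only [crossEnt, ← Finset.sum_neg_distrib, Finset.mul_sum]
    rw [← Finset.sum_sub_distrib, ← Finset.sum_sub_distrib, ← Finset.sum_add_distrib,
      ← Finset.sum_sub_distrib]
    refine Finset.sum_congr rfl fun ω _ => ?_
    by_cases h0 : q ω = 0
    · simp [h0]
    rw [hFG, hF, hG, log_prod fun i _ => hsupp ω h0 i, log_prod fun i _ => hX ω h0 i,
      log_prod fun i _ => hY ω h0 i]
    simp only [potential, add_sub_cancel_right, Finset.sum_add_distrib, Finset.sum_sub_distrib,
      Finset.sum_neg_distrib, ← Finset.mul_sum, Finset.sum_const, Finset.card_univ,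
      Fintype.card_fin, nsmul_eq_mul]
    ring
  have hlin := sum_mul_sum_le (law_mem_stdSimplex hp fun t => t.1) hB0 hlB
    (by simpa using hA.centred) hδ hq.1 hqr hF ha han
  have hFcross := crossEnt_le_ent_sub_log hδ hq hqr F
  have hFM : ent q F ≤ ent q (fun ω => (M ω, F ω)) :=
    ent_le_of_imp hq.1 fun ω ω' h => (Prod.mk.inj h).2
  rw [hpot] at key
  have h1 := mul_le_mul_of_nonneg_left hM (show 0 ≤ a ^ 3 + b by positivity)
  have h2 := mul_le_mul_of_nonneg_left (hFcross.trans (sub_le_sub_right hFM _)) hb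
  have ha3 : 1 ≤ a ^ 3 := one_le_pow₀ ha
  have h3 : n * (K / a) ≤ K * a ^ 3 := by
    calc n * (K / a) ≤ a ^ 4 * (K / a) := mul_le_mul_of_nonneg_right han (by positivity)
      _ = K * a ^ 3 := by field_simp
  have h4 : B * exp 1 / δ * a ^ 2 ≤ B * exp 1 / δ * a ^ 3 :=
    mul_le_mul_of_nonneg_left (pow_le_pow_right₀ ha (by norm_num)) (by positivity)
  have h5 : 2 * b * -log δ ≤ 2 * b * -log δ * a ^ 3 :=
    le_mul_of_one_le_right (by positivity) ha3
  simp only [add_sub_cancel_right] at key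
  linarith

end Change

/-! ### Weighted information of a Markov chain -/

section Channel

variable {X Y : Type*} [Fintype X] [Fintype Y] {p : X × Y → ℝ} {Ω U : Type*} [Fintype Ω]
  [Fintype U] {q : Ω → ℝ}

lemma le_mutualInfo_sub (hq : q ∈ stdSimplex ℝ Ω) {b c A : ℝ} {l : X → ℝ}
    (hA : IsAffineMinorant p b c A l)
    (f : Ω → U) (g : Ω → X) (h : Ω → Y)
    (hM : IsMarkovChain q f g h) (hgh : law q (fun ω => (g ω, h ω)) = p) :
    A ≤ b * mutualInfo q f g - c * mutualInfo q f h := by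
  have hg : ∀ x, law p (fun t => t.1) x = law q g x := fun x => by
    rw [← hgh, ← law_comp]
  rw [mutualInfo_eq_sum_infoFn hq.1 b c f g h hM hgh]
  have h1 := Finset.sum_le_sum fun u (_ : u ∈ Finset.univ) =>
    hA.le_infoFn (fun x => law q (fun ω => (f ω, g ω)) (u, x)) (fun x => law_nonneg hq.1 _ _)
      fun x hx => le_antisymm (by
        rw [← hx, hg]
        exact law_le_of_imp hq.1 fun ω h => (Prod.mk.inj h).2) (law_nonneg hq.1 _ _)
  refine le_trans (le_of_eq ?_) h1
  have e1 : ∑ u, ∑ x, law q (fun ω => (f ω, g ω)) (u, x) = 1 := by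
    rw [← Fintype.sum_prod_type', ← hq.2, ← sum_law q fun ω => (f ω, g ω)]
  have e2 : ∑ u, ∑ x, law q (fun ω => (f ω, g ω)) (u, x) * l x = 0 := by
    rw [Finset.sum_comm, ← hA.centred]
    simp only [← Finset.sum_mul, ← law_eq_sum_pair_right, hg]
  rw [Finset.sum_add_distrib, ← Finset.mul_sum, e1, e2]
  ring

/-- If `(g, h) ∼ p` and `f` is the output of the channel `a` with input `g`, then `f - g - h` is a
Markov chain, whose weighted information is determined by `p` and `a`. -/
lemma isMarkovChain_and_mutualInfo_of_law (hq : ∀ ω, 0 ≤ q ω) {a : X → U → ℝ}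
    (ha : ∀ x, a x ∈ stdSimplex ℝ U) {f : Ω → U} {g : Ω → X} {h : Ω → Y}
    (hlaw : ∀ u x y, law q (fun ω => (f ω, g ω, h ω)) (u, x, y) = p (x, y) * a x u) (b c : ℝ) :
    IsMarkovChain q f g h ∧ b * mutualInfo q f g - c * mutualInfo q f h =
      ∑ u, infoFn p b c (fun x => law p (fun t => t.1) x * a x u) := by
  have hgh : law q (fun ω => (g ω, h ω)) = p := by
    funext ⟨x, y⟩
    rw [law_eq_sum_pair_right q f]
    simp only [hlaw, ← Finset.mul_sum, (ha x).2, mul_one]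
  have hg : ∀ x, law q g x = law p (fun t => t.1) x := fun x => by
    rw [← hgh, ← law_comp]
  have hfg : ∀ u x, law q (fun ω => (f ω, g ω)) (u, x) = law p (fun t => t.1) x * a x u := by
    intro u x
    rw [law_eq_sum_pair_left q _ h, law_fst_eq_sum, Finset.sum_mul]
    refine Finset.sum_congr rfl fun y _ => ?_
    rw [← hlaw]
    exact law_congr_of_iff q fun ω => by simp only [Prod.mk.injEq]; tauto
  have hM : IsMarkovChain q f g h := fun u x y => by
    rw [hlaw, hg, hfg, hgh]
    ring
  refine ⟨hM, ?_⟩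
  rw [mutualInfo_eq_sum_infoFn hq b c f g h hM hgh]
  simp only [hfg]

end Channel

/-! ### The optimal weighted information -/

section Region

variable {X Y Z : Type*} [Fintype X] [Fintype Y] [Fintype Z] {P : X × Y × Z → ℝ}

lemma law_xy_eq_sum (P : X × Y × Z → ℝ) (x : X) (y : Y) :
    law P (fun t => (t.1, t.2.1)) (x, y) = ∑ z, P (x, y, z) := by
  classical
  rw [law_eq_sum_ite]
  simp only [Fintype.sum_prod_type, Prod.mk.injEq, ite_and]
  rw [Finset.sum_eq_single x, Finset.sum_eq_single y] <;> simp +contextual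

lemma law_yz_eq_sum (P : X × Y × Z → ℝ) (y : Y) (z : Z) :
    law P (fun t => (t.2.1, t.2.2)) (y, z) = ∑ x, P (x, y, z) := by
  classical
  rw [law_eq_sum_ite]
  simp only [Fintype.sum_prod_type, Prod.mk.injEq, ite_and]
  simp

/-- The weighted information separates into three parts that involve `U₁`, `U₂` and `V` alone, and
the three auxiliary variables can be chosen conditionally independent given the sources. Hence its
minimum is the sum of the three lower convex envelopes. -/
theorem isLeast_weightedInfoValues (hP : P ∈ stdSimplex ℝ (X × Y × Z)) {b₁ b₂ c d A₁ A₂ A₃ : ℝ}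
    {l₁ l₂ : X → ℝ} {l₃ : Y → ℝ}
    (hA₁ : IsAffineMinorant (law P fun t => (t.1, t.2.1)) b₁ 1 A₁ l₁)
    (hA₂ : IsAffineMinorant (law P fun t => (t.1, t.2.1)) b₂ c A₂ l₂)
    (hA₃ : IsAffineMinorant (law P fun t => (t.2.1, t.2.2)) d c A₃ l₃)
    {k₁ k₂ k₃ : ℕ} {a₁ : X → Fin k₁ → ℝ} {a₂ : X → Fin k₂ → ℝ} {a₃ : Y → Fin k₃ → ℝ}
    (ha₁ : ∀ x, a₁ x ∈ stdSimplex ℝ (Fin k₁)) (ha₂ : ∀ x, a₂ x ∈ stdSimplex ℝ (Fin k₂))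
    (ha₃ : ∀ x, a₃ x ∈ stdSimplex ℝ (Fin k₃))
    (hv₁ : ∑ u, infoFn (law P fun t => (t.1, t.2.1)) b₁ 1
      (fun x => law (law P fun t => (t.1, t.2.1)) (fun t => t.1) x * a₁ x u) = A₁)
    (hv₂ : ∑ u, infoFn (law P fun t => (t.1, t.2.1)) b₂ c
      (fun x => law (law P fun t => (t.1, t.2.1)) (fun t => t.1) x * a₂ x u) = A₂)
    (hv₃ : ∑ u, infoFn (law P fun t => (t.2.1, t.2.2)) d c
      (fun x => law (law P fun t => (t.2.1, t.2.2)) (fun t => t.1) x * a₃ x u) = A₃) :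
    IsLeast (weightedInfoValues P b₁ b₂ c d) (A₁ + A₂ + A₃) := by
  classical
  constructor
  · set Q : X × Y × Z × Fin k₁ × Fin k₂ × Fin k₃ → ℝ := fun ω =>
      P (ω.1, ω.2.1, ω.2.2.1) * a₁ ω.1 ω.2.2.2.1 * a₂ ω.1 ω.2.2.2.2.1 * a₃ ω.2.1 ω.2.2.2.2.2
      with hQ
    have hQ0 : ∀ ω, 0 ≤ Q ω := fun ω =>
      mul_nonneg (mul_nonneg (mul_nonneg (hP.1 _) ((ha₁ _).1 _)) ((ha₂ _).1 _)) ((ha₃ _).1 _)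
    have hsource : law Q (fun ω => (ω.1, ω.2.1, ω.2.2.1)) = P := by
      funext ⟨x, y, z⟩
      rw [law_eq_sum_ite]
      simp only [Fintype.sum_prod_type, Prod.mk.injEq, ite_and, hQ]
      simp [← Finset.mul_sum, (ha₁ _).2, (ha₂ _).2, (ha₃ _).2]
    have hsum : ∑ ω, Q ω = 1 := by
      rw [← sum_law Q (fun ω => (ω.1, ω.2.1, ω.2.2.1)), hsource, hP.2]
    have h1 : ∀ u x y, law Q (fun ω => (ω.2.2.2.1, ω.1, ω.2.1)) (u, x, y) =
        law P (fun t => (t.1, t.2.1)) (x, y) * a₁ x u := by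
      intro u x y
      rw [law_eq_sum_ite, law_xy_eq_sum]
      simp only [Fintype.sum_prod_type, Prod.mk.injEq, ite_and, hQ]
      simp [← Finset.mul_sum, ← Finset.sum_mul, (ha₂ _).2, (ha₃ _).2]
    have h2 : ∀ u x y, law Q (fun ω => (ω.2.2.2.2.1, ω.1, ω.2.1)) (u, x, y) =
        law P (fun t => (t.1, t.2.1)) (x, y) * a₂ x u := by
      intro u x y
      rw [law_eq_sum_ite, law_xy_eq_sum]
      simp only [Fintype.sum_prod_type, Prod.mk.injEq, ite_and, hQ]
      simp [← Finset.mul_sum, ← Finset.sum_mul, (ha₁ _).2, (ha₃ _).2]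
    have h3 : ∀ u y z, law Q (fun ω => (ω.2.2.2.2.2, ω.2.1, ω.2.2.1)) (u, y, z) =
        law P (fun t => (t.2.1, t.2.2)) (y, z) * a₃ y u := by
      intro u y z
      rw [law_eq_sum_ite, law_yz_eq_sum]
      simp only [Fintype.sum_prod_type, Prod.mk.injEq, ite_and, hQ]
      simp [← Finset.mul_sum, ← Finset.sum_mul, (ha₁ _).2, (ha₂ _).2]
    obtain ⟨m1, i1⟩ := isMarkovChain_and_mutualInfo_of_law hQ0 ha₁ h1 b₁ 1
    obtain ⟨m2, i2⟩ := isMarkovChain_and_mutualInfo_of_law hQ0 ha₂ h2 b₂ c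
    obtain ⟨m3, i3⟩ := isMarkovChain_and_mutualInfo_of_law hQ0 ha₃ h3 d c
    refine ⟨k₁, k₂, k₃, Q, ⟨⟨hQ0, hsum⟩, hsource, m1, m2, m3⟩, ?_⟩
    rw [hv₁] at i1
    rw [hv₂] at i2
    rw [hv₃] at i3
    rw [weightedInfo, ← i1, ← i2, ← i3]
    ring
  · rintro _ ⟨k₁, k₂, k₃, Q, hQ, rfl⟩
    have hXY : law Q (fun ω => (ω.1, ω.2.1)) = law P fun t => (t.1, t.2.1) := by
      rw [← hQ.law_source, ← law_comp]
    have hYZ : law Q (fun ω => (ω.2.1, ω.2.2.1)) = law P fun t => (t.2.1, t.2.2) := by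
      rw [← hQ.law_source, ← law_comp]
    have i1 := le_mutualInfo_sub hQ.mem_simplex hA₁ _ _ _ hQ.markov_U₁ hXY
    have i2 := le_mutualInfo_sub hQ.mem_simplex hA₂ _ _ _ hQ.markov_U₂ hXY
    have i3 := le_mutualInfo_sub hQ.mem_simplex hA₃ _ _ _ hQ.markov_V hYZ
    rw [weightedInfo]
    linarith

end Region

/-! ### Conditioning on acceptance, and the two hypotheses -/

section ChangeOfMeasure

/-- Conditioning on an event `E` of probability at least `1 - ε` gives a distribution on `E` with
density at most `1 / (1 - ε)`. -/
lemma exists_conditioned {Ω : Type*} [Fintype Ω] {r : Ω → ℝ} (hr : r ∈ stdSimplex ℝ Ω)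
    {E : Set Ω} {ε : ℝ} (hε : ε < 1) (hE : prob r Eᶜ ≤ ε) :
    ∃ q ∈ stdSimplex ℝ Ω, (∀ ω, (1 - ε) * q ω ≤ r ω) ∧ ∀ ω, q ω ≠ 0 → ω ∈ E := by
  classical
  have hsum : prob r E + prob r Eᶜ = 1 := by
    rw [← hr.2, prob, prob, ← Finset.sum_add_distrib]
    exact Finset.sum_congr rfl fun ω _ => Set.indicator_self_add_compl_apply E r ω
  have hpos : 0 < prob r E := by linarith
  have hnn : ∀ ω, 0 ≤ E.indicator r ω := fun ω => Set.indicator_nonneg (fun ω _ => hr.1 ω) ω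
  refine ⟨fun ω => E.indicator r ω / prob r E, ⟨fun ω => div_nonneg (hnn ω) hpos.le, ?_⟩,
    fun ω => ?_, fun ω h => ?_⟩
  · rw [← Finset.sum_div]
    exact div_self hpos.ne'
  · have h1 : E.indicator r ω ≤ r ω := Set.indicator_le_self' (fun ω _ => hr.1 ω) ω
    rw [← mul_div_assoc, div_le_iff₀ hpos]
    nlinarith [hnn ω, hr.1 ω]
  · by_contra hω
    simp [hω] at h

variable {X Y Z : Type*} [Fintype X] [Fintype Y] [Fintype Z] {P : X × Y × Z → ℝ} {n : ℕ}

lemma law_nullLaw_fst (P : X × Y × Z → ℝ) (x : Fin n → X) :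
    law (nullLaw P n) (fun s => s.1) x = ∏ i, law P (fun t => t.1) (x i) :=
  law_nullLaw P n (fun t => t.1) x

lemma law_nullLaw_snd (P : X × Y × Z → ℝ) (y : Fin n → Y) :
    law (nullLaw P n) (fun s => s.2.1) y = ∏ i, law P (fun t => t.2.1) (y i) :=
  law_nullLaw P n (fun t => t.2.1) y

lemma law_nullLaw_trd (P : X × Y × Z → ℝ) (z : Fin n → Z) :
    law (nullLaw P n) (fun s => s.2.2) z = ∏ i, law P (fun t => t.2.2) (z i) :=
  law_nullLaw P n (fun t => t.2.2) z

lemma altLaw_nonneg (hP : ∀ t, 0 ≤ P t) (s : (Fin n → X) × (Fin n → Y) × (Fin n → Z)) :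
    0 ≤ altLaw P n s :=
  mul_nonneg (mul_nonneg (Finset.prod_nonneg fun _ _ => law_nonneg hP _ _)
    (Finset.prod_nonneg fun _ _ => law_nonneg hP _ _))
    (Finset.prod_nonneg fun _ _ => law_nonneg hP _ _)

lemma altLaw_ne_zero (hP : ∀ t, 0 ≤ P t) {s : (Fin n → X) × (Fin n → Y) × (Fin n → Z)}
    (hs : nullLaw P n s ≠ 0) : altLaw P n s ≠ 0 := by
  have h : ∀ i, P (s.1 i, s.2.1 i, s.2.2 i) ≠ 0 := fun i =>
    Finset.prod_ne_zero_iff.1 hs i (Finset.mem_univ i)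
  refine mul_ne_zero (mul_ne_zero ?_ ?_) ?_ <;> refine Finset.prod_ne_zero_iff.2 fun i _ => ?_
  · exact (law_pos hP (fun t => t.1) (h i)).ne'
  · exact (law_pos hP (fun t => t.2.1) (h i)).ne'
  · exact (law_pos hP (fun t => t.2.2) (h i)).ne'

/-- Under the alternative hypothesis, a function of the first source is independent of the second
source, and both have the same laws as under the null hypothesis. -/
lemma law_altLaw_fst_snd {T : Type*} (hP : P ∈ stdSimplex ℝ (X × Y × Z)) (φ : (Fin n → X) → T)
    (m : T) (y : Fin n → Y) :
    law (altLaw P n) (fun s => (φ s.1, s.2.1)) (m, y) =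
      law (nullLaw P n) (fun s => φ s.1) m * law (nullLaw P n) (fun s => s.2.1) y := by
  classical
  rw [law_comp (nullLaw P n) (fun s => s.1) φ, law_nullLaw_snd, law_eq_sum_ite, law_eq_sum_ite]
  simp only [law_nullLaw_fst, altLaw, Fintype.sum_prod_type, Prod.mk.injEq, ite_and]
  rw [Finset.sum_mul]
  refine Finset.sum_congr rfl fun x _ => ?_
  split_ifs
  · rw [Finset.sum_eq_single y]
    · simp [← Finset.mul_sum, sum_prod_law hP n fun t => t.2.2]
    · intro y' _ h
      simp [h]
    · simp
  · simp

/-- Under the alternative hypothesis, a function of the first two sources is independent of the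
third source. -/
lemma law_altLaw_trd {T : Type*} (hP : P ∈ stdSimplex ℝ (X × Y × Z))
    (φ : (Fin n → X) → (Fin n → Y) → T) (m : T) (z : Fin n → Z) :
    law (altLaw P n) (fun s => (φ s.1 s.2.1, s.2.2)) (m, z) =
      law (altLaw P n) (fun s => φ s.1 s.2.1) m * law (nullLaw P n) (fun s => s.2.2) z := by
  classical
  rw [law_nullLaw_trd, law_eq_sum_ite, law_eq_sum_ite]
  simp only [altLaw, Fintype.sum_prod_type, Prod.mk.injEq, ite_and, Finset.sum_mul]
  refine Finset.sum_congr rfl fun x _ => Finset.sum_congr rfl fun y _ => ?_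
  split_ifs
  · rw [← Finset.sum_mul, ← Finset.mul_sum, sum_prod_law hP n fun t => t.2.2]
    simp
  · simp

lemma crossEnt_altLaw_fst_snd {T : Type*} (hP : P ∈ stdSimplex ℝ (X × Y × Z))
    (φ : (Fin n → X) → T) {q : (Fin n → X) × (Fin n → Y) × (Fin n → Z) → ℝ}
    (hq : ∀ s, q s ≠ 0 → nullLaw P n s ≠ 0) :
    crossEnt q (altLaw P n) (fun s => (φ s.1, s.2.1)) =
      crossEnt q (nullLaw P n) (fun s => φ s.1) + crossEnt q (nullLaw P n) (fun s => s.2.1) := by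
  have hr := (nullLaw_mem_stdSimplex hP n).1
  rw [crossEnt, crossEnt, crossEnt, ← neg_add, ← Finset.sum_add_distrib]
  congr 1
  refine Finset.sum_congr rfl fun s _ => ?_
  by_cases h0 : q s = 0
  · simp [h0]
  rw [law_altLaw_fst_snd hP, log_mul, mul_add]
  · exact (law_pos hr (fun s => φ s.1) (hq s h0)).ne'
  · exact (law_pos hr (fun s => s.2.1) (hq s h0)).ne'

lemma crossEnt_altLaw_trd {T : Type*} (hP : P ∈ stdSimplex ℝ (X × Y × Z))
    (φ : (Fin n → X) → (Fin n → Y) → T) {q : (Fin n → X) × (Fin n → Y) × (Fin n → Z) → ℝ}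
    (hq : ∀ s, q s ≠ 0 → nullLaw P n s ≠ 0) :
    crossEnt q (altLaw P n) (fun s => (φ s.1 s.2.1, s.2.2)) =
      crossEnt q (altLaw P n) (fun s => φ s.1 s.2.1) +
        crossEnt q (nullLaw P n) (fun s => s.2.2) := by
  have hr := (nullLaw_mem_stdSimplex hP n).1
  rw [crossEnt, crossEnt, crossEnt, ← neg_add, ← Finset.sum_add_distrib]
  congr 1
  refine Finset.sum_congr rfl fun s _ => ?_
  by_cases h0 : q s = 0
  · simp [h0]
  rw [law_altLaw_trd hP, log_mul, mul_add]
  · exact (law_pos (altLaw_nonneg hP.1) (fun s => φ s.1 s.2.1)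
      (altLaw_ne_zero hP.1 (hq s h0))).ne'
  · exact (law_pos hr (fun s => s.2.2) (hq s h0)).ne'

/-- The Markov chain `X - Y - Z` in terms of log-likelihoods of the sequences. -/
lemma crossEnt_add_crossEnt_of_markov (hP : P ∈ stdSimplex ℝ (X × Y × Z))
    (hMarkov : IsMarkovChain P (fun t => t.1) (fun t => t.2.1) (fun t => t.2.2))
    {q : (Fin n → X) × (Fin n → Y) × (Fin n → Z) → ℝ}
    (hq : ∀ s, q s ≠ 0 → nullLaw P n s ≠ 0) :
    crossEnt q (nullLaw P n) (fun s i => (s.1 i, s.2.1 i, s.2.2 i)) +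
        crossEnt q (nullLaw P n) (fun s => s.2.1) =
      crossEnt q (nullLaw P n) (fun s i => (s.1 i, s.2.1 i)) +
        crossEnt q (nullLaw P n) (fun s i => (s.2.1 i, s.2.2 i)) := by
  rw [crossEnt, crossEnt, crossEnt, crossEnt, ← neg_add, ← neg_add, ← Finset.sum_add_distrib,
    ← Finset.sum_add_distrib]
  congr 1
  refine Finset.sum_congr rfl fun s _ => ?_
  by_cases h0 : q s = 0
  · simp [h0]
  have hs : ∀ i, P (s.1 i, s.2.1 i, s.2.2 i) ≠ 0 := fun i =>
    Finset.prod_ne_zero_iff.1 (hq s h0) i (Finset.mem_univ i)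
  have e1 := law_nullLaw P n (fun t => (t.1, t.2.1, t.2.2)) fun i => (s.1 i, s.2.1 i, s.2.2 i)
  have e2 := law_nullLaw P n (fun t => (t.1, t.2.1)) fun i => (s.1 i, s.2.1 i)
  have e3 := law_nullLaw P n (fun t => (t.2.1, t.2.2)) fun i => (s.2.1 i, s.2.2 i)
  simp only at e1 e2 e3
  have n1 : ∀ i ∈ Finset.univ, law P (fun t => (t.1, t.2.1, t.2.2))
      (s.1 i, s.2.1 i, s.2.2 i) ≠ 0 := fun i _ =>
    (law_pos hP.1 (fun t => (t.1, t.2.1, t.2.2)) (hs i)).ne'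
  have n2 : ∀ i ∈ Finset.univ, law P (fun t => (t.1, t.2.1)) (s.1 i, s.2.1 i) ≠ 0 := fun i _ =>
    (law_pos hP.1 (fun t => (t.1, t.2.1)) (hs i)).ne'
  have n3 : ∀ i ∈ Finset.univ, law P (fun t => (t.2.1, t.2.2)) (s.2.1 i, s.2.2 i) ≠ 0 :=
    fun i _ => (law_pos hP.1 (fun t => (t.2.1, t.2.2)) (hs i)).ne'
  have n4 : ∀ i ∈ Finset.univ, law P (fun t => t.2.1) (s.2.1 i) ≠ 0 := fun i _ =>
    (law_pos hP.1 (fun t => t.2.1) (hs i)).ne'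
  rw [e1, e2, e3, law_nullLaw_snd, ← mul_add, ← mul_add,
    ← log_mul (Finset.prod_ne_zero_iff.2 n1) (Finset.prod_ne_zero_iff.2 n4),
    ← log_mul (Finset.prod_ne_zero_iff.2 n2) (Finset.prod_ne_zero_iff.2 n3),
    ← Finset.prod_mul_distrib, ← Finset.prod_mul_distrib]
  simp only [hMarkov _ _ _]

end ChangeOfMeasure

/-! ### The converse for the two links -/

section Converse

variable {X Y Z : Type*} [Fintype X] [Fintype Y] [Fintype Z] {P : X × Y × Z → ℝ} {n N₁ N₂ : ℕ}

lemma ent_le_log {Ω : Type*} [Fintype Ω] {q : Ω → ℝ} (hq : q ∈ stdSimplex ℝ Ω) {N : ℕ}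
    (M : Ω → Fin N) : ent q M ≤ log N := by
  obtain ⟨ω, -⟩ := exists_ne_zero_of_mem_stdSimplex hq
  have : Nonempty (Fin N) := ⟨M ω⟩
  simpa using ent_le_log_card hq M

/-- The converse for the link from the transmitter to the relay. With `M₁ = f₁(Xⁿ)`, the factor of
`c` is `I(M₁; Yⁿ) + D(q_Yⁿ ‖ P_Yⁿ)` under the change of measure `q`. -/
lemma exists_transmitter_converse (hP : P ∈ stdSimplex ℝ (X × Y × Z)) {b c A : ℝ} (hb : 0 ≤ b)
    (hc : 0 ≤ c) {l : X → ℝ}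
    (hA : IsAffineMinorant (law P fun t => (t.1, t.2.1)) b c A l)
    {δ : ℝ} (hδ : 0 < δ) (hδ1 : δ ≤ 1) :
    ∃ C : ℝ, 0 ≤ C ∧ ∀ (n N₁ : ℕ) (a : ℝ), 1 ≤ a → (n : ℝ) ≤ a ^ 4 →
      ∀ q ∈ stdSimplex ℝ ((Fin n → X) × (Fin n → Y) × (Fin n → Z)),
      (∀ s, δ * q s ≤ nullLaw P n s) → ∀ f₁ : (Fin n → X) → Fin N₁,
      n * A - C * a ^ 3 ≤ b * log N₁ - c * (ent q (fun s => f₁ s.1) -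
        ent q (fun s => (f₁ s.1, s.2.1)) + crossEnt q (nullLaw P n) (fun s => s.2.1)) := by
  obtain ⟨C, hC, h⟩ := exists_multiletter_converse (law_mem_stdSimplex hP _) hb hc hA hδ hδ1
  refine ⟨C, hC, fun n N₁ a ha han q hq hqr f₁ => ?_⟩
  have hr := nullLaw_mem_stdSimplex hP n
  have hqr0 : ∀ s, q s ≠ 0 → nullLaw P n s ≠ 0 := fun s => ne_zero_of_mul_le hδ hq.1 hqr
  have h1 := h n a ha han _ _ q (nullLaw P n) hq hr.1 hqr (fun s => s.1) (fun s => s.2.1)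
    (fun t => law_nullLaw P n (fun t => (t.1, t.2.1)) t)
    (fun x => by rw [← law_comp]; exact law_nullLaw_fst P x)
    (fun y => by rw [← law_comp]; exact law_nullLaw_snd P y) N₁ (fun s => f₁ s.1) (by
      have e1 : ent q (fun s => (f₁ s.1, s.1)) = ent q (fun s => s.1) :=
        ent_congr q fun ω ω' => by
          simp only [Prod.mk.injEq, and_iff_right_iff_imp]
          intro h
          rw [h]
      have e2 : ent q (fun s => (f₁ s.1, s.1, s.2.1)) = ent q (fun s i => (s.1 i, s.2.1 i)) :=
        ent_congr q fun ω ω' => by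
          simp only [Prod.mk.injEq, funext_iff, forall_and, and_iff_right_iff_imp, and_imp]
          intro h _
          rw [funext h]
      have h2 := crossEnt_le_ent_sub_log hδ hq hqr (fun s i => (s.1 i, s.2.1 i))
      have h3 := ent_le_crossEnt hq.1 hr.1 hqr0 (hr.2.trans hq.2.symm).le (fun s => s.1)
      rw [e1, e2]
      linarith)
  have h2 := mul_le_mul_of_nonneg_left (ent_le_log hq fun s => f₁ s.1) hb
  linarith

/-- The converse for the link from the relay to the receiver. The message `M₂ = f(Xⁿ, Yⁿ)` also
depends on `Xⁿ`, so `M₂ - Yⁿ - Zⁿ` need not be a Markov chain under `q`; as `X - Y - Z` is one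
under `P`, the defect is at most the relative entropy of `q`. -/
lemma exists_relay_receiver_converse (hP : P ∈ stdSimplex ℝ (X × Y × Z))
    (hMarkov : IsMarkovChain P (fun t => t.1) (fun t => t.2.1) (fun t => t.2.2))
    {d c A : ℝ} (hd : 0 ≤ d) (hc : 0 ≤ c) {l : Y → ℝ}
    (hA : IsAffineMinorant (law P fun t => (t.2.1, t.2.2)) d c A l)
    {δ : ℝ} (hδ : 0 < δ) (hδ1 : δ ≤ 1) :
    ∃ C : ℝ, 0 ≤ C ∧ ∀ (n N₂ : ℕ) (a : ℝ), 1 ≤ a → (n : ℝ) ≤ a ^ 4 →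
      ∀ q ∈ stdSimplex ℝ ((Fin n → X) × (Fin n → Y) × (Fin n → Z)),
      (∀ s, δ * q s ≤ nullLaw P n s) → ∀ f : (Fin n → X) → (Fin n → Y) → Fin N₂,
      n * A - C * a ^ 3 ≤ d * log N₂ - c * (ent q (fun s => f s.1 s.2.1) -
        ent q (fun s => (f s.1 s.2.1, s.2.2)) + crossEnt q (nullLaw P n) (fun s => s.2.2)) := by
  obtain ⟨C, hC, h⟩ := exists_multiletter_converse (law_mem_stdSimplex hP _) hd hc hA hδ hδ1
  refine ⟨C, hC, fun n N₂ a ha han q hq hqr f => ?_⟩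
  have hr := nullLaw_mem_stdSimplex hP n
  have hqr0 : ∀ s, q s ≠ 0 → nullLaw P n s ≠ 0 := fun s => ne_zero_of_mul_le hδ hq.1 hqr
  have h1 := h n a ha han _ _ q (nullLaw P n) hq hr.1 hqr (fun s => s.2.1) (fun s => s.2.2)
    (fun t => law_nullLaw P n (fun t => (t.2.1, t.2.2)) t)
    (fun x => by rw [← law_comp]; exact law_nullLaw_snd P x)
    (fun y => by rw [← law_comp]; exact law_nullLaw_trd P y) N₂ (fun s => f s.1 s.2.1) (by
      -- `H(Z | X, Y) ≤ H(Z | M₂, Y)`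
      have h0 := ent_submodular hq.1 (fun s => (f s.1 s.2.1, s.2.1)) (fun s => s.1)
        (fun s => s.2.2)
      have e1 : ent q (fun s => ((f s.1 s.2.1, s.2.1), s.1, s.2.2)) =
          ent q (fun s i => (s.1 i, s.2.1 i, s.2.2 i)) := ent_congr q fun ω ω' => by
        simp only [Prod.mk.injEq, funext_iff, forall_and]
        constructor
        · tauto
        · rintro ⟨h1, h2, h3⟩
          rw [funext h1, funext h2]
          tauto
      have e2 : ent q (fun s => ((f s.1 s.2.1, s.2.1), s.1)) =
          ent q (fun s i => (s.1 i, s.2.1 i)) := ent_congr q fun ω ω' => by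
        simp only [Prod.mk.injEq, funext_iff, forall_and]
        constructor
        · tauto
        · rintro ⟨h1, h2⟩
          rw [funext h1, funext h2]
          tauto
      have e3 : ent q (fun s => ((f s.1 s.2.1, s.2.1), s.2.2)) =
          ent q (fun s => (f s.1 s.2.1, s.2.1, s.2.2)) := ent_congr q fun ω ω' => by
        simp only [Prod.mk.injEq]
        tauto
      rw [e1, e2, e3] at h0
      have h2 := crossEnt_le_ent_sub_log hδ hq hqr (fun s i => (s.1 i, s.2.1 i, s.2.2 i))
      have h3 := ent_le_crossEnt hq.1 hr.1 hqr0 (hr.2.trans hq.2.symm).le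
        (fun s i => (s.1 i, s.2.1 i))
      have h4 := crossEnt_add_crossEnt_of_markov hP hMarkov hqr0
      linarith)
  have h2 := mul_le_mul_of_nonneg_left (ent_le_log hq fun s => f s.1 s.2.1) hd
  linarith

lemma pow_three_le_rpow_mul_log (n : ℕ) :
    (((n : ℝ) + 1) ^ (1 / 4 : ℝ)) ^ 3 ≤ 4 * ((n : ℝ) ^ (3 / 4 : ℝ) * log n + 1) := by
  have hn : (0 : ℝ) ≤ n := n.cast_nonneg
  rw [← rpow_natCast, ← rpow_mul (by positivity)]
  norm_num only
  have h2 : (2 : ℝ) ^ (3 / 4 : ℝ) ≤ 2 := by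
    simpa using rpow_le_rpow_of_exponent_le one_le_two (show (3 / 4 : ℝ) ≤ 1 by norm_num)
  rcases le_or_gt 2 n with h | h
  · have h' : (2 : ℝ) ≤ n := by exact_mod_cast h
    have h1 : ((n : ℝ) + 1) ^ (3 / 4 : ℝ) ≤ (2 * n) ^ (3 / 4 : ℝ) :=
      rpow_le_rpow (by positivity) (by linarith) (by norm_num)
    rw [mul_rpow (by norm_num) hn] at h1
    have h3 : (0 : ℝ) ≤ (n : ℝ) ^ (3 / 4 : ℝ) := rpow_nonneg hn _
    have h4 : 1 / 2 ≤ log n :=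
      le_trans (by linarith [log_two_gt_d9]) (log_le_log two_pos h')
    nlinarith
  · have h' : (n : ℝ) + 1 ≤ 2 := by
      have : (n : ℝ) ≤ 1 := by exact_mod_cast Nat.lt_succ_iff.1 h
      linarith
    have h1 : ((n : ℝ) + 1) ^ (3 / 4 : ℝ) ≤ 2 ^ (3 / 4 : ℝ) :=
      rpow_le_rpow (by positivity) h' (by norm_num)
    have h3 : 0 ≤ (n : ℝ) ^ (3 / 4 : ℝ) * log n :=
      mul_nonneg (rpow_nonneg hn _) (log_natCast_nonneg n)
    linarith

lemma isTheta_const_mul_add_one {C : ℝ} (hC : C ≠ 0) :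
    (fun n : ℕ => C * ((n : ℝ) ^ (3 / 4 : ℝ) * log n + 1)) =Θ[atTop]
      (fun n : ℕ => (n : ℝ) ^ (3 / 4 : ℝ) * log n) := by
  have ht : Tendsto (fun n : ℕ => (n : ℝ) ^ (3 / 4 : ℝ) * log n) atTop atTop :=
    ((tendsto_rpow_atTop (by norm_num)).comp tendsto_natCast_atTop_atTop).atTop_mul_atTop₀
      (tendsto_log_atTop.comp tendsto_natCast_atTop_atTop)
  refine (Asymptotics.isTheta_const_mul_left hC).2 ?_
  refine (Asymptotics.isTheta_refl _ _).add_isLittleO ?_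
  exact Asymptotics.isLittleO_const_left.2 (Or.inr (tendsto_norm_atTop_atTop.comp ht))

end Converse

end TwoHop

end

theorem theorem3 {X Y Z : Type*} [Fintype X] [Fintype Y] [Fintype Z]
    (P : X × Y × Z → ℝ) (hP : P ∈ stdSimplex ℝ (X × Y × Z))
    (hMarkov : TwoHop.IsMarkovChain P (fun t => t.1) (fun t => t.2.1) (fun t => t.2.2))
    (ε₁ ε₂ : ℝ) (hε₁ : ε₁ ∈ Set.Ioo (0 : ℝ) 1) (hε₂ : ε₂ ∈ Set.Ioo (0 : ℝ) 1)
    (hε : 1 < ε₁ + ε₂)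
    (b₁ b₂ c d : ℝ) (hb₁ : 0 ≤ b₁) (hb₂ : 0 ≤ b₂) (hc : 0 ≤ c) (hd : 0 ≤ d) :
    IsLeast (TwoHop.weightedInfoValues P b₁ b₂ c d) (TwoHop.RTilde P b₁ b₂ c d) ∧
    ∃ e : ℕ → ℝ,
      e =Θ[Filter.atTop] (fun n : ℕ => (n : ℝ) ^ (3 / 4 : ℝ) * Real.log n) ∧
      ∀ (n N₁ N₂ : ℕ) (K : TwoHop.Code X Y Z n N₁ N₂), K.β₁ P ≤ ε₁ → K.η₁ P ≤ ε₂ →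
        (n : ℝ) * TwoHop.RTilde P b₁ b₂ c d + e n ≤
          Real.log (K.β₂ P) + b₁ * Real.log N₁ + b₂ * Real.log N₁ +
            c * Real.log (K.η₂ P) + d * Real.log N₂ := by
  open TwoHop Real in
  have hXY := law_mem_stdSimplex hP fun t => (t.1, t.2.1)
  have hYZ := law_mem_stdSimplex hP fun t => (t.2.1, t.2.2)
  obtain ⟨A₁, l₁, hA₁, k₁, a₁, ha₁, hv₁⟩ := exists_infoFn_envelope hXY b₁ 1
  obtain ⟨A₂, l₂, hA₂, k₂, a₂, ha₂, hv₂⟩ := exists_infoFn_envelope hXY b₂ c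
  obtain ⟨A₃, l₃, hA₃, k₃, a₃, ha₃, hv₃⟩ := exists_infoFn_envelope hYZ d c
  have hleast := isLeast_weightedInfoValues hP hA₁ hA₂ hA₃ ha₁ ha₂ ha₃ hv₁ hv₂ hv₃
  have hR : RTilde P b₁ b₂ c d = A₁ + A₂ + A₃ := hleast.csInf_eq
  refine ⟨hR ▸ hleast, ?_⟩
  have hδ₁ : 0 < 1 - ε₁ := sub_pos.2 hε₁.2
  have hδ₂ : 0 < 1 - ε₂ := sub_pos.2 hε₂.2
  have hδ₁' : 1 - ε₁ ≤ 1 := by linarith [hε₁.1]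
  have hδ₂' : 1 - ε₂ ≤ 1 := by linarith [hε₂.1]
  obtain ⟨C₁, hC₁, h₁⟩ := exists_transmitter_converse hP hb₁ zero_le_one hA₁ hδ₁ hδ₁'
  obtain ⟨C₂, hC₂, h₂⟩ := exists_transmitter_converse hP hb₂ hc hA₂ hδ₂ hδ₂'
  obtain ⟨C₃, hC₃, h₃⟩ := exists_relay_receiver_converse hP hMarkov hd hc hA₃ hδ₂ hδ₂'
  have hL₁ : 0 ≤ -log (1 - ε₁) := neg_nonneg.2 (log_nonpos hδ₁.le hδ₁')
  have hL₂ : 0 ≤ -log (1 - ε₂) := neg_nonneg.2 (log_nonpos hδ₂.le hδ₂')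
  set C := C₁ + C₂ + C₃ + -log (1 - ε₁) + c * -log (1 - ε₂) with hC
  have hC0 : 0 ≤ C := by positivity
  -- the total error is `C a ^ 3` with `a ^ 4 = n + 1`; the summand `1` covers `n = 0` and `n = 1`,
  -- where `n ^ (3 / 4) log n` vanishes
  refine ⟨fun n => -(4 * C + 1) * ((n : ℝ) ^ (3 / 4 : ℝ) * log n + 1),
    isTheta_const_mul_add_one (by linarith), fun n N₁ N₂ K hβ hη => ?_⟩
  set a : ℝ := ((n : ℝ) + 1) ^ (1 / 4 : ℝ) with ha
  have hn : (0 : ℝ) ≤ n := n.cast_nonneg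
  have ha1 : 1 ≤ a := one_le_rpow (by linarith) (by norm_num)
  have ha4 : (n : ℝ) ≤ a ^ 4 := by
    rw [ha, ← rpow_natCast, ← rpow_mul (by positivity)]
    norm_num
  have ha3 : 1 ≤ a ^ 3 := one_le_pow₀ ha1
  have hr := nullLaw_mem_stdSimplex hP n
  have halt := altLaw_nonneg (n := n) hP.1
  -- the relay test, under the null hypothesis conditioned on acceptance at the relay
  have hrelay : n * A₁ - C₁ * a ^ 3 + log (1 - ε₁) ≤ log (K.β₂ P) + b₁ * log N₁ := by
    obtain ⟨q, hq, hqr, hqE⟩ := exists_conditioned hr (E := {s | K.relayDecision s = .H0})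
      hε₁.2 (by
        convert hβ using 2
        rw [Code.β₁]
        congr 1
        ext s
        cases h : K.relayDecision s <;> simp [h])
    have hqr0 : ∀ s, q s ≠ 0 → nullLaw P n s ≠ 0 := fun _ => ne_zero_of_mul_le hδ₁ hq.1 hqr
    have g1 := h₁ n N₁ a ha1 ha4 q hq hqr K.f₁
    have g2 := neg_log_prob_le hq halt (fun s h => altLaw_ne_zero hP.1 (hqr0 s h))
      (fun s => (K.f₁ s.1, s.2.1)) {t | K.g₁ t.1 t.2 = .H0} hqE
    rw [crossEnt_altLaw_fst_snd hP K.f₁ hqr0] at g2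
    have g3 := crossEnt_le_ent_sub_log hδ₁ hq hqr fun s => K.f₁ s.1
    have g4 : prob (altLaw P n) {s | (K.f₁ s.1, s.2.1) ∈ {t | K.g₁ t.1 t.2 = .H0}} = K.β₂ P := rfl
    rw [g4] at g2
    linarith
  -- the receiver test, under the null hypothesis conditioned on acceptance at the receiver
  have hreceiver : n * A₂ + n * A₃ - (C₂ + C₃) * a ^ 3 + c * log (1 - ε₂) ≤
      b₂ * log N₁ + c * log (K.η₂ P) + d * log N₂ := by
    obtain ⟨q, hq, hqr, hqE⟩ := exists_conditioned hr (E := {s | K.receiverDecision s = .H0})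
      hε₂.2 (by
        convert hη using 2
        rw [Code.η₁]
        congr 1
        ext s
        cases h : K.receiverDecision s <;> simp [h])
    have hqr0 : ∀ s, q s ≠ 0 → nullLaw P n s ≠ 0 := fun _ => ne_zero_of_mul_le hδ₂ hq.1 hqr
    have hqalt : ∀ s, q s ≠ 0 → altLaw P n s ≠ 0 := fun s h => altLaw_ne_zero hP.1 (hqr0 s h)
    have g1 := h₂ n N₁ a ha1 ha4 q hq hqr K.f₁
    have g2 := h₃ n N₂ a ha1 ha4 q hq hqr fun x y => K.f₂ (K.f₁ x) y
    have g3 := neg_log_prob_le hq halt hqalt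
      (fun s => (K.f₂ (K.f₁ s.1) s.2.1, s.2.2)) {t | K.g₂ t.1 t.2 = .H0} hqE
    rw [crossEnt_altLaw_trd hP (fun x y => K.f₂ (K.f₁ x) y) hqr0] at g3
    have g4 := crossEnt_sub_ent_comp_le hq.1 halt hqalt (fun s => (K.f₁ s.1, s.2.1))
      fun t => K.f₂ t.1 t.2
    rw [crossEnt_altLaw_fst_snd hP K.f₁ hqr0] at g4
    have g5 := crossEnt_le_ent_sub_log hδ₂ hq hqr fun s => K.f₁ s.1
    have g6 : prob (altLaw P n)
      {s | (K.f₂ (K.f₁ s.1) s.2.1, s.2.2) ∈ {t | K.g₂ t.1 t.2 = .H0}} = K.η₂ P := rfl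
    rw [g6] at g3
    simp only at g4
    have g7 : -log (K.η₂ P) ≤
        (ent q (fun s => K.f₁ s.1) - ent q (fun s => (K.f₁ s.1, s.2.1)) +
          crossEnt q (nullLaw P n) (fun s => s.2.1)) +
        (ent q (fun s => K.f₂ (K.f₁ s.1) s.2.1) -
          ent q (fun s => (K.f₂ (K.f₁ s.1) s.2.1, s.2.2)) +
          crossEnt q (nullLaw P n) (fun s => s.2.2)) - log (1 - ε₂) := by
      linarith
    have g8 := mul_le_mul_of_nonneg_left g7 hc
    linarith
  have hfin := mul_le_mul_of_nonneg_left (pow_three_le_rpow_mul_log n) hC0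
  have hnn : 0 ≤ (n : ℝ) ^ (3 / 4 : ℝ) * log n :=
    mul_nonneg (rpow_nonneg hn _) (log_natCast_nonneg n)
  have hlog₁ : -log (1 - ε₁) ≤ -log (1 - ε₁) * a ^ 3 := le_mul_of_one_le_right hL₁ ha3
  have hlog₂ : c * -log (1 - ε₂) ≤ c * -log (1 - ε₂) * a ^ 3 :=
    le_mul_of_one_le_right (mul_nonneg hc hL₂) ha3
  have hCa : C * a ^ 3 = C₁ * a ^ 3 + (C₂ + C₃) * a ^ 3 + -log (1 - ε₁) * a ^ 3 +
      c * -log (1 - ε₂) * a ^ 3 := by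
    rw [hC]
    ring
  rw [hR]
  linarith
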